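/- Fix integers $n\ge 2$ and $\ell\ge 1$. A \emph{row of beads} is a set of positions in $\mathbb Z+\frac12$ in which only finitely many negative positions are empty and only finitely many positive positions are full. An ($\ell$-strand) \emph{abacus configuration} $\psi$ consists of rows $\psi_0,\dots,\psi_{\ell-1}$, numbered from bottom to top. Let $\psi_i^j$ ($j\ge1$) be the position of the $j$-th bead from the right on row $i$, and extend to all $i\in\mathbb Z$ by $\psi_{i+\ell}^j=\psi_i^j-n$. The configuration is \emph{descending} if $\psi_i^j\ge\psi_{i+1}^j$ for all $i\in\mathbb Z$, $j\ge1$. The \emph{compactification} of $\psi$ is obtained by pushing all beads to the left within their rows, using finitely many moves; $\psi$ is \emph{compact} if it equals its compactification. Color the gap at each integer $g$ (between the positions $g-\frac12$ and $g+\frac12$) with $c_{g \bmod n}$. For $0\le i\le n-1$, write a bracket ``('' each time a bead on one of the rows $0,\dots,\ell-1$ could move one step to the right across a $c_i$-colored gap into an empty position, and a ``)'' each time a bead could move one step to the left across a $c_i$-colored gap into an empty position; the brackets are ordered by going up each $c_i$-colored gap in turn, the gaps being taken from left to right. Matching pairs ``( )'' are canceled as usual. Then $f_i(\psi)$ is obtained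 by moving the bead of the first uncanceled ``('' from the left one step to the right, and $f_i(\psi)=0$ if there is none; $e_i(\psi)$ is obtained by moving the bead of the first uncanceled ``)'' from the right one step to the left, and $e_i(\psi)=0$ if there is none. These operators preserve the set of descending configurations together with $0$. For $k\ge1$ and $\psi$ descending, $T_k(\psi)$ is obtained by replacing $\psi_i^k$ by $\psi_{i+1}^k$ for all $i$ if $\psi_{i+1}^k>\psi_i^{k+1}$ for all $i$, and $T_k(\psi)=0$ otherwise; $T_k^*(\psi)$ is obtained by replacing $\psi_i^k$ by $\psi_{i-1}^k$ for all $i$ if $\psi_{i-1}^k<\psi_i^{k-1}$ for all $i$ (no condition if $k=1$), and $T_k^*(\psi)=0$ otherwise. All operators send $0$ to $0$. A descending configuration $\psi$ is \emph{tight} if, for each $k$, its beads $\psi_i^k$ are as far to the left as possible among all descending configurations that have the same beads $\psi_i^j$, $j\ne k$, and the same multiset of residues modulo $n$ of the positions of the $k$-th beads on the rows $0,\dots,\ell-1$. Let $\psi_{(0)}$ be a compact descending configuration, and let $G$ be the colored directed graph whose vertices are all descending configurations with compactification $\psi_{(0)}$, with an edge of color $c_i$ from $\psi$ to $\phi$ if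 and only if $f_i(\psi)=\phi$. Then: 1. For all $0\le i\le n-1$ and $k\ge 1$, the operators $e_i$ and $f_i$, restricted to the set of descending configurations (with any compactification), commute with $T_k$ and with $T_k^*$. 2. The sources of $G$ (the vertices that are not the end of any edge) are exactly the configurations that can be obtained from $\psi_{(0)}$ by a finite (possibly empty) sequence of moves $T_k^*$ for various $k$. 3. The set of tight vertices of $G$ is a connected component of (the undirected graph underlying) $G$. 4. If an edge connecting $\psi$ and $\phi$ is added to $G$ whenever $T_k(\psi)=\phi$ for some $k$, then $G$ becomes connected. -/

import Mathlib

open Filter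

/-- A bead configuration on an `ℓ`-strand abacus.  The integer `p` stands for the half-integer
position `p - 1/2`.  `bead i j` is the position of the `(j+1)`-st bead from the right (so `j = 0` is
the rightmost bead) on row `i`; the physical rows are `0, …, ℓ - 1`, counted from the bottom, and the
rows are extended to all `i : ℤ` by `ψ_{i+ℓ}^j = ψ_i^j - n`.  A row with finitely many empty negative
positions and finitely many full positive positions is the same thing as a strictly decreasing
sequence of positions which is eventually of the form `c - j`. -/
@[ext]
structure Abacus (n ℓ : ℕ) where
  bead : ℤ → ℕ → ℤ
  strictAnti : ∀ i, StrictAnti (bead i)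
  eventually_packed : ∀ i, ∃ c : ℤ, ∀ᶠ j : ℕ in atTop, bead i j = c - j
  periodic : ∀ i j, bead (i + ℓ) j = bead i j - n

namespace Abacus

variable {n ℓ : ℕ}

/-- The charge of row `i`: pushing all its beads to the left, the last bead is at `c - 1/2`. -/
noncomputable def charge (ψ : Abacus n ℓ) (i : ℤ) : ℤ := (ψ.eventually_packed i).choose

theorem charge_spec (ψ : Abacus n ℓ) (i : ℤ) :
    ∀ᶠ j : ℕ in atTop, ψ.bead i j = ψ.charge i - j := (ψ.eventually_packed i).choose_spec

theorem charge_periodic (ψ : Abacus n ℓ) (i : ℤ) : ψ.charge (i + ℓ) = ψ.charge i - n := by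
  obtain ⟨j, h1, h2⟩ := ((ψ.charge_spec i).and (ψ.charge_spec (i + ℓ))).exists
  have := ψ.periodic i j
  omega

/-- The compactification: all beads are pushed to the left, within their rows, by finitely many
moves (so that far to the left nothing changes). -/
noncomputable def compactification (ψ : Abacus n ℓ) : Abacus n ℓ where
  bead i j := ψ.charge i - j
  strictAnti i := by
    intro a b hab
    show ψ.charge i - (b : ℤ) < ψ.charge i - (a : ℤ)
    omega
  eventually_packed i := ⟨ψ.charge i, Eventually.of_forall fun _ => rfl⟩
  periodic i j := by
    have := ψ.charge_periodic i
    omega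

/-- `ψ_i ≥ ψ_{i+1}` for all `i`. -/
def Descending (ψ : Abacus n ℓ) : Prop := ∀ i j, ψ.bead (i + 1) j ≤ ψ.bead i j

/-- There is a bead at position `p - 1/2` of row `r`. -/
def Occupied (ψ : Abacus n ℓ) (r p : ℤ) : Prop := ∃ j, ψ.bead r j = p

/-! ### The brackets

The gap between the positions `g - 1/2` and `g + 1/2` has colour `c_{g mod n}`.  The places where a
bracket for the colour `c_i` may stand, moving up each `c_i`-coloured gap in turn from left to right,
are numbered by the integers: place `t` is on the row `t mod ℓ`, at the gap `i + n ⌊t / ℓ⌋`. -/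

/-- The row (between `0` and `ℓ - 1`) of the place `t`. -/
def placeRow (ℓ : ℕ) (t : ℤ) : ℤ := t % (ℓ : ℤ)

/-- The gap of the place `t`. -/
def placeGap {n : ℕ} (ℓ : ℕ) (i : Fin n) (t : ℤ) : ℤ := (i : ℤ) + n * (t / (ℓ : ℤ))

/-- There is a `(` at place `t`: the bead on the left of the gap can move right across it. -/
def HasOpen (ψ : Abacus n ℓ) (i : Fin n) (t : ℤ) : Prop :=
  ψ.Occupied (placeRow ℓ t) (placeGap ℓ i t) ∧ ¬ ψ.Occupied (placeRow ℓ t) (placeGap ℓ i t + 1)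

/-- There is a `)` at place `t`: the bead on the right of the gap can move left across it. -/
def HasClose (ψ : Abacus n ℓ) (i : Fin n) (t : ℤ) : Prop :=
  ψ.Occupied (placeRow ℓ t) (placeGap ℓ i t + 1) ∧ ¬ ψ.Occupied (placeRow ℓ t) (placeGap ℓ i t)

open Classical in
/-- The number of `(` at the places in `s`. -/
noncomputable def numOpen (ψ : Abacus n ℓ) (i : Fin n) (s : Finset ℤ) : ℕ :=
  (s.filter fun t => ψ.HasOpen i t).card

open Classical in
/-- The number of `)` at the places in `s`. -/
noncomputable def numClose (ψ : Abacus n ℓ) (i : Fin n) (s : Finset ℤ) : ℕ :=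
  (s.filter fun t => ψ.HasClose i t).card

/-- The place `t` carries a `(` that is not canceled: no initial segment of the brackets after it
contains more `)` than `(`. -/
def UncanceledOpen (ψ : Abacus n ℓ) (i : Fin n) (t : ℤ) : Prop :=
  ψ.HasOpen i t ∧ ∀ u, ψ.numClose i (Finset.Ioc t u) ≤ ψ.numOpen i (Finset.Ioc t u)

/-- The place `t` carries a `)` that is not canceled: no final segment of the brackets before it
contains more `(` than `)`. -/
def UncanceledClose (ψ : Abacus n ℓ) (i : Fin n) (t : ℤ) : Prop :=
  ψ.HasClose i t ∧ ∀ u, ψ.numOpen i (Finset.Ico u t) ≤ ψ.numClose i (Finset.Ico u t)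

theorem periodic_mul (ψ : Abacus n ℓ) (i : ℤ) (j : ℕ) (m : ℤ) :
    ψ.bead (i + ℓ * m) j = ψ.bead i j - n * m := by
  induction m using Int.induction_on with
  | zero => simp
  | succ m ih =>
    have := ψ.periodic (i + ℓ * m) j
    rw [show i + (ℓ : ℤ) * ((m : ℤ) + 1) = i + ℓ * m + ℓ by ring, this, ih]
    ring
  | pred m ih =>
    have := ψ.periodic (i + ℓ * (-(m : ℤ) - 1)) j
    rw [show i + (ℓ : ℤ) * (-(m : ℤ) - 1) + ℓ = i + ℓ * (-(m : ℤ)) by ring, ih] at this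
    linarith

theorem bead_of_dvd (ψ : Abacus n ℓ) {r i : ℤ} (h : (ℓ : ℤ) ∣ i - r) :
    ∃ m : ℤ, ∀ j, ψ.bead i j = ψ.bead r j - n * m := by
  obtain ⟨m, hm⟩ := h
  refine ⟨m, fun j => ?_⟩
  rw [← ψ.periodic_mul, ← hm, add_sub_cancel]

theorem dvd_add_iff (r i : ℤ) : (ℓ : ℤ) ∣ i + ℓ - r ↔ (ℓ : ℤ) ∣ i - r := by
  rw [show i + (ℓ : ℤ) - r = i - r + ℓ by ring]
  exact dvd_add_self_right

/-- Move bead `j` of the row `r` one step in the direction `d` (which is `1` or `-1`), if the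
target is free.  The copies of the row `r` in the extended abacus move along. -/
noncomputable def move (ψ : Abacus n ℓ) (r : ℤ) (j : ℕ) (d : ℤ) (hd : d = 1 ∨ d = -1)
    (h : ¬ ψ.Occupied r (ψ.bead r j + d)) : Abacus n ℓ where
  bead i k := ψ.bead i k + if k = j ∧ (ℓ : ℤ) ∣ i - r then d else 0
  strictAnti i := by
    refine strictAnti_nat_of_succ_lt fun k => ?_
    have h0 := ψ.strictAnti i (Nat.lt_succ_self k)
    by_cases hi : (ℓ : ℤ) ∣ i - r
    · obtain ⟨m, hm⟩ := ψ.bead_of_dvd hi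
      have h1 : ψ.bead r (k + 1) ≠ ψ.bead r j + d := fun e => h ⟨_, e⟩
      have h2 : ψ.bead r k ≠ ψ.bead r j + d := fun e => h ⟨_, e⟩
      simp only [hi, and_true]
      simp only [hm, Nat.succ_eq_add_one] at h0 ⊢
      by_cases a : k = j
      · subst a
        rw [if_neg (by omega), if_pos rfl]
        omega
      · by_cases b : k + 1 = j
        · subst b
          rw [if_pos rfl, if_neg (by omega)]
          omega
        · rw [if_neg a, if_neg b]
          omega
    · simpa [hi] using h0
  eventually_packed i := by
    obtain ⟨c, hc⟩ := ψ.eventually_packed i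
    refine ⟨c, ?_⟩
    filter_upwards [hc, eventually_gt_atTop j] with k hk hj
    rw [if_neg (by omega), hk, add_zero]
  periodic i k := by
    simp only [ψ.periodic, dvd_add_iff]
    ring

/-- The bead that can move right across the gap of a place with a `(`. -/
theorem HasOpen.exists_bead {ψ : Abacus n ℓ} {i : Fin n} {t : ℤ} (h : ψ.HasOpen i t) :
    ∃ j, ψ.bead (placeRow ℓ t) j = placeGap ℓ i t ∧
      ¬ ψ.Occupied (placeRow ℓ t) (ψ.bead (placeRow ℓ t) j + 1) := by
  obtain ⟨⟨j, hj⟩, h2⟩ := h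
  exact ⟨j, hj, by rwa [hj]⟩

/-- The bead that can move left across the gap of a place with a `)`. -/
theorem HasClose.exists_bead {ψ : Abacus n ℓ} {i : Fin n} {t : ℤ} (h : ψ.HasClose i t) :
    ∃ j, ψ.bead (placeRow ℓ t) j = placeGap ℓ i t + 1 ∧
      ¬ ψ.Occupied (placeRow ℓ t) (ψ.bead (placeRow ℓ t) j + -1) := by
  obtain ⟨⟨j, hj⟩, h2⟩ := h
  exact ⟨j, hj, by rwa [hj, add_neg_cancel_right]⟩

open Classical in
/-- `f_i`: move the bead of the first uncanceled `(` from the left one step to the right, if there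
is one; otherwise the result is `0`, written `none`. -/
noncomputable def f (i : Fin n) (ψ : Abacus n ℓ) : Option (Abacus n ℓ) :=
  if h : ∃ t, IsLeast {t | ψ.UncanceledOpen i t} t then
    some (ψ.move (placeRow ℓ h.choose) h.choose_spec.1.1.exists_bead.choose 1 (Or.inl rfl)
      h.choose_spec.1.1.exists_bead.choose_spec.2)
  else none

open Classical in
/-- `e_i`: move the bead of the first uncanceled `)` from the right one step to the left, if there
is one; otherwise the result is `0`, written `none`. -/
noncomputable def e (i : Fin n) (ψ : Abacus n ℓ) : Option (Abacus n ℓ) :=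
  if h : ∃ t, IsGreatest {t | ψ.UncanceledClose i t} t then
    some (ψ.move (placeRow ℓ h.choose) h.choose_spec.1.1.exists_bead.choose (-1) (Or.inr rfl)
      h.choose_spec.1.1.exists_bead.choose_spec.2)
  else none

/-! ### The operators preserve descending configurations -/

theorem bead_place (ψ : Abacus n ℓ) (t : ℤ) (j : ℕ) :
    ψ.bead t j = ψ.bead (placeRow ℓ t) j - n * (t / (ℓ : ℤ)) := by
  rw [← ψ.periodic_mul, placeRow, Int.emod_add_mul_ediv]

theorem occupied_place (ψ : Abacus n ℓ) (i : Fin n) (t d : ℤ) :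
    ψ.Occupied (placeRow ℓ t) (placeGap ℓ i t + d) ↔ ψ.Occupied t (i + d) := by
  refine exists_congr fun j => ?_
  rw [bead_place ψ t j, placeGap]
  constructor <;> intro h <;> linarith

theorem hasOpen_iff (ψ : Abacus n ℓ) (i : Fin n) (t : ℤ) :
    ψ.HasOpen i t ↔ ψ.Occupied t i ∧ ¬ ψ.Occupied t (i + 1) := by
  have h := ψ.occupied_place i t 0
  rw [add_zero, add_zero] at h
  rw [HasOpen, h, occupied_place]

theorem hasClose_iff (ψ : Abacus n ℓ) (i : Fin n) (t : ℤ) :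
    ψ.HasClose i t ↔ ψ.Occupied t (i + 1) ∧ ¬ ψ.Occupied t i := by
  have h := ψ.occupied_place i t 0
  rw [add_zero, add_zero] at h
  rw [HasClose, h, occupied_place]

theorem UncanceledOpen.pred {ψ : Abacus n ℓ} {i : Fin n} {t : ℤ} (h : ψ.UncanceledOpen i t)
    (h' : ψ.HasOpen i (t - 1)) : ψ.UncanceledOpen i (t - 1) := by
  classical
  refine ⟨h', fun u => ?_⟩
  rcases lt_or_ge u t with hu | hu
  · rw [Finset.Ioc_eq_empty (by omega)]
    simp [numOpen, numClose]
  · have hI : Finset.Ioc (t - 1) u = insert t (Finset.Ioc t u) := by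
      ext x
      simp only [Finset.mem_Ioc, Finset.mem_insert]
      omega
    have hc : ¬ ψ.HasClose i t := fun hc => h.1.2 hc.1
    have := h.2 u
    unfold numOpen numClose at *
    rw [hI, Finset.filter_insert, Finset.filter_insert, if_neg hc, if_pos h.1]
    exact this.trans (Finset.card_le_card (Finset.subset_insert _ _))

theorem UncanceledClose.succ {ψ : Abacus n ℓ} {i : Fin n} {t : ℤ} (h : ψ.UncanceledClose i t)
    (h' : ψ.HasClose i (t + 1)) : ψ.UncanceledClose i (t + 1) := by
  classical
  refine ⟨h', fun u => ?_⟩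
  rcases lt_or_ge t u with hu | hu
  · rw [Finset.Ico_eq_empty (by omega)]
    simp [numOpen, numClose]
  · have hI : Finset.Ico u (t + 1) = insert t (Finset.Ico u t) := by
      ext x
      simp only [Finset.mem_Ico, Finset.mem_insert]
      omega
    have hc : ¬ ψ.HasOpen i t := fun hc => h.1.2 hc.1
    have := h.2 u
    unfold numOpen numClose at *
    rw [hI, Finset.filter_insert, Finset.filter_insert, if_neg hc, if_pos h.1]
    exact this.trans (Finset.card_le_card (Finset.subset_insert _ _))

theorem dvd_sub_placeRow {t i : ℤ} : (ℓ : ℤ) ∣ i - placeRow ℓ t ↔ (ℓ : ℤ) ∣ i - t := by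
  have h : (ℓ : ℤ) ∣ t - placeRow ℓ t := Int.dvd_self_sub_emod
  rw [show i - placeRow ℓ t = (i - t) + (t - placeRow ℓ t) by ring]
  exact dvd_add_left h

theorem descending_move {ψ : Abacus n ℓ} (hψ : ψ.Descending) {r : ℤ} {j : ℕ} {d : ℤ}
    (hd : d = 1 ∨ d = -1) (h : ¬ ψ.Occupied r (ψ.bead r j + d))
    (h1 : d = 1 → ψ.bead r j < ψ.bead (r - 1) j) (h2 : d = -1 → ψ.bead (r + 1) j < ψ.bead r j) :
    (ψ.move r j d hd h).Descending := by
  intro i k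
  have h0 := hψ i k
  simp only [move]
  by_cases hk : k = j
  · subst hk
    simp only [true_and]
    by_cases a : (ℓ : ℤ) ∣ i - r <;> by_cases b : (ℓ : ℤ) ∣ i + 1 - r
    · rw [if_pos a, if_pos b]; omega
    · rw [if_pos a, if_neg b]
      obtain ⟨m, hm⟩ := ψ.bead_of_dvd a
      obtain ⟨m', hm'⟩ := a
      have e1 := ψ.periodic_mul r k m'
      have e2 := ψ.periodic_mul (r + 1) k m'
      rw [show r + 1 + (ℓ : ℤ) * m' = i + 1 by linarith] at e2
      rw [show r + (ℓ : ℤ) * m' = i by linarith] at e1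
      rcases hd with hd | hd
      · omega
      · have := h2 hd
        omega
    · rw [if_neg a, if_pos b]
      obtain ⟨m', hm'⟩ := b
      have e1 := ψ.periodic_mul r k m'
      have e2 := ψ.periodic_mul (r - 1) k m'
      rw [show r - 1 + (ℓ : ℤ) * m' = i by linarith] at e2
      rw [show r + (ℓ : ℤ) * m' = i + 1 by linarith] at e1
      rcases hd with hd | hd
      · have := h1 hd
        omega
      · omega
    · rw [if_neg a, if_neg b]; omega
  · simpa [hk] using h0

theorem bead_place_sub (ψ : Abacus n ℓ) (t s : ℤ) (j : ℕ) :
    ψ.bead (t + s) j = ψ.bead (placeRow ℓ t + s) j - n * (t / (ℓ : ℤ)) := by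
  rw [← ψ.periodic_mul]
  congr 1
  have := Int.emod_add_mul_ediv t ℓ
  unfold placeRow
  linarith

theorem Descending.f {ψ φ : Abacus n ℓ} (hψ : ψ.Descending) {i : Fin n} (h : ψ.f i = some φ) :
    φ.Descending := by
  unfold Abacus.f at h
  split_ifs at h with ht
  obtain rfl := Option.some.inj h
  refine descending_move hψ _ _ (fun _ => ?_) (by omega)
  have hj := ht.choose_spec.1.1.exists_bead.choose_spec
  have hl := ht.choose_spec
  generalize ht.choose_spec.1.1.exists_bead.choose = j at hj ⊢
  generalize ht.choose = t at hj hl ⊢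
  by_contra hc
  have e0 := ψ.bead_place t j
  have e1 := ψ.bead_place_sub t (-1) j
  have hg : ψ.bead t j = i := by
    rw [e0, hj.1, placeGap]; ring
  have e2 := hψ (t - 1) j
  rw [sub_add_cancel] at e2
  rw [← sub_eq_add_neg, ← sub_eq_add_neg] at e1
  have hg' : ψ.bead (t - 1) j = i := by omega
  have ho : ψ.HasOpen i (t - 1) := by
    rw [hasOpen_iff]
    refine ⟨⟨j, hg'⟩, ?_⟩
    rintro ⟨k, hk⟩
    have hkj : k < j := by
      rw [← (ψ.strictAnti (t - 1)).lt_iff_gt]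
      omega
    have e3 := hψ (t - 1) k
    rw [sub_add_cancel] at e3
    have e4 := ψ.strictAnti t hkj
    exact ((ψ.hasOpen_iff i t).1 hl.1.1).2 ⟨k, by omega⟩
  have := hl.2 (hl.1.pred ho)
  omega

theorem Descending.e {ψ φ : Abacus n ℓ} (hψ : ψ.Descending) {i : Fin n} (h : ψ.e i = some φ) :
    φ.Descending := by
  unfold Abacus.e at h
  split_ifs at h with ht
  obtain rfl := Option.some.inj h
  refine descending_move hψ _ _ (by omega) (fun _ => ?_)
  have hj := ht.choose_spec.1.1.exists_bead.choose_spec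
  have hl := ht.choose_spec
  generalize ht.choose_spec.1.1.exists_bead.choose = j at hj ⊢
  generalize ht.choose = t at hj hl ⊢
  by_contra hc
  have e0 := ψ.bead_place t j
  have e1 := ψ.bead_place_sub t 1 j
  have hg : ψ.bead t j = i + 1 := by
    rw [e0, hj.1, placeGap]; ring
  have e2 := hψ t j
  have hg' : ψ.bead (t + 1) j = i + 1 := by omega
  have ho : ψ.HasClose i (t + 1) := by
    rw [hasClose_iff]
    refine ⟨⟨j, hg'⟩, ?_⟩
    rintro ⟨k, hk⟩
    have hkj : j < k := by
      rw [← (ψ.strictAnti (t + 1)).lt_iff_gt]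
      omega
    have e3 := hψ t k
    have e4 := ψ.strictAnti t hkj
    exact ((ψ.hasClose_iff i t).1 hl.1.1).2 ⟨k, by omega⟩
  have := hl.2 (hl.1.succ ho)
  omega

end Abacus

/-- The descending bead configurations. -/
def DescAbacus (n ℓ : ℕ) : Type := {ψ : Abacus n ℓ // ψ.Descending}

namespace DescAbacus

variable {n ℓ : ℕ}

/-- The position of bead `j` of row `i`. -/
def bead (ψ : DescAbacus n ℓ) : ℤ → ℕ → ℤ := ψ.1.bead

/-- The restriction of `f_i` to the descending configurations. -/
noncomputable def f (i : Fin n) (ψ : DescAbacus n ℓ) : Option (DescAbacus n ℓ) :=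
  (ψ.1.f i).pmap (fun φ hφ => ⟨φ, hφ⟩) fun _ h => ψ.2.f h

/-- The restriction of `e_i` to the descending configurations. -/
noncomputable def e (i : Fin n) (ψ : DescAbacus n ℓ) : Option (DescAbacus n ℓ) :=
  (ψ.1.e i).pmap (fun φ hφ => ⟨φ, hφ⟩) fun _ h => ψ.2.e h

/-- The configuration in which bead `k` of each row `i` is put at the position of bead `k` of the
row `i + s`. -/
noncomputable def shiftBead (ψ : DescAbacus n ℓ) (k : ℕ) (s : ℤ)
    (h1 : ∀ i, ψ.bead i (k + 1) < ψ.bead (i + s) k)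
    (h2 : ∀ i m, m + 1 = k → ψ.bead (i + s) k < ψ.bead i m) : DescAbacus n ℓ where
  val :=
    { bead := fun i j => if j = k then ψ.bead (i + s) j else ψ.bead i j
      strictAnti := fun i => by
        refine strictAnti_nat_of_succ_lt fun j => ?_
        have h0 := ψ.1.strictAnti i (Nat.lt_succ_self j)
        by_cases a : j = k
        · subst a
          rw [if_neg (by omega), if_pos rfl]
          exact h1 i
        · by_cases b : j + 1 = k
          · rw [if_pos b, if_neg a, b]
            exact h2 i j b
          · rw [if_neg a, if_neg b]
            exact h0
      eventually_packed := fun i => by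
        obtain ⟨c, hc⟩ := ψ.1.eventually_packed i
        refine ⟨c, ?_⟩
        filter_upwards [hc, eventually_gt_atTop k] with j hj hk
        rw [if_neg (by omega)]
        exact hj
      periodic := fun i j => by
        have e1 := ψ.1.periodic i j
        have e2 := ψ.1.periodic (i + s) j
        rw [show i + s + (ℓ : ℤ) = i + ℓ + s by ring] at e2
        unfold bead
        split_ifs
        · exact e2
        · exact e1 }
  property := fun i j => by
    have e1 := ψ.2 i j
    have e2 := ψ.2 (i + s) j
    rw [show i + s + 1 = i + 1 + s by ring] at e2
    show (if j = k then ψ.bead (i + 1 + s) j else ψ.bead (i + 1) j) ≤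
      if j = k then ψ.bead (i + s) j else ψ.bead i j
    split_ifs
    · exact e2
    · exact e1

open Classical in
/-- The tightening operator: `T k` replaces `ψ_i^{k+1}` by `ψ_{i+1}^{k+1}` for all rows `i` if
this stays strictly to the right of `ψ_i^{k+2}` on every row; otherwise the result is `0`.
(Beads are numbered from `0` here, so `T k` moves the `(k+1)`-st beads.) -/
noncomputable def T (k : ℕ) (ψ : DescAbacus n ℓ) : Option (DescAbacus n ℓ) :=
  if h : ∀ i, ψ.bead i (k + 1) < ψ.bead (i + 1) k then
    some (ψ.shiftBead k 1 h fun i m hm =>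
      (ψ.2 i k).trans_lt (ψ.1.strictAnti i (by omega)))
  else none

open Classical in
/-- The operator `T_k^*`: it replaces `ψ_i^{k+1}` by `ψ_{i-1}^{k+1}` for all rows `i` if this
stays strictly to the left of `ψ_i^k` on every row (no condition for the rightmost beads, `k = 0`);
otherwise the result is `0`. -/
noncomputable def Tstar (k : ℕ) (ψ : DescAbacus n ℓ) : Option (DescAbacus n ℓ) :=
  if h : ∀ i m, m + 1 = k → ψ.bead (i + -1) k < ψ.bead i m then
    some (ψ.shiftBead k (-1)
      (fun i => (ψ.1.strictAnti i (Nat.lt_succ_self k)).trans_le (by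
        have := ψ.2 (i + -1) k
        rwa [neg_add_cancel_right] at this)) h)
  else none

/-- The residues modulo `n` of the positions of the beads `k` on the `ℓ` rows, with
multiplicity. -/
def residues (ψ : DescAbacus n ℓ) (k : ℕ) : Multiset (ZMod n) :=
  (Finset.range ℓ).val.map fun r => (ψ.bead r k : ZMod n)

/-- A descending configuration is tight if, for each `k`, the beads `k` of its rows are as far to
the left as possible, among all descending configurations with the same other beads and
the same positions of the beads `k` modulo `n`. -/
def IsTight (ψ : DescAbacus n ℓ) : Prop :=
  ∀ (k : ℕ) (φ : DescAbacus n ℓ), (∀ i j, j ≠ k → φ.bead i j = ψ.bead i j) →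
    φ.residues k = ψ.residues k → ∀ i, ψ.bead i k ≤ φ.bead i k

/-- The vertices of the graph `G`: the descending configurations with compactification `ψ₀`. -/
def Vertex (ψ₀ : DescAbacus n ℓ) : Type :=
  {ψ : DescAbacus n ℓ // ψ.1.compactification = ψ₀.1}

/-- The edges of `G`: there is an edge of colour `c_i` from `ψ` to `φ` if `f_i ψ = φ`. -/
def Edge (ψ₀ : DescAbacus n ℓ) (i : Fin n) (ψ φ : Vertex ψ₀) : Prop := ψ.1.f i = some φ.1

/-- A source of `G`: a vertex that is not the end of any edge. -/
def IsSource {ψ₀ : DescAbacus n ℓ} (φ : Vertex ψ₀) : Prop := ∀ i ψ, ¬ Edge ψ₀ i ψ φ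

/-- The undirected, uncoloured graph underlying `G`. -/
def graph (ψ₀ : DescAbacus n ℓ) : SimpleGraph (Vertex ψ₀) :=
  SimpleGraph.fromRel fun ψ φ => ∃ i, Edge ψ₀ i ψ φ

/-- The undirected graph underlying `G` together with an edge between `ψ` and `φ` whenever
`T_k ψ = φ` for some `k`. -/
def graphWithT (ψ₀ : DescAbacus n ℓ) : SimpleGraph (Vertex ψ₀) :=
  SimpleGraph.fromRel fun ψ φ => (∃ i, Edge ψ₀ i ψ φ) ∨ ∃ k, ψ.1.T k = some φ.1

end DescAbacus

/-! A descending configuration is encoded by the integers `firstRow v k`. On the extended abacus all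
places of colour `c_i` become the single gap `i` read along the rows `t : ℤ`, so the bracket word is
a lattice path in `t` (`walk`). Because the configuration is descending, the `)` of bead `m` stand
just before row `firstRow i m` and its `(` start there; where the `(` of bead `m + 1` and the `)` of
bead `m` would overlap, both positions are filled and there is no bracket. Hence the low points of
the path are the rows `firstRow i m`, and their heights are, up to a constant, `potential i m`, a
sum of differences `gap (i - 1) j - gap i j`. The operator `f_i` adds 1 to `firstRow i K` for the
smallest minimizer `K` of the potential, and `e_i` subtracts 1 for the largest one (`f_eq_some_iff`,
`e_eq_some_iff`).

In these coordinates `T k` subtracts 1 from `firstRow v k` for all `v`. It changes each gap by an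
amount independent of `v`, so the potential does not change; this gives the commutation. Moreover `T
k` gives `0` exactly when some `gap v k` vanishes.

If no `e_i` applies, every potential is minimal on its constant tail, and periodicity in `v` then
forces `gap v k` to be independent of `v` (`gap_eq_gap_of_e_eq_none`). If no `T k` applies either,
all gaps vanish and the configuration is compact. Since `e_i` and `T k` lower `weight`, every vertex
is reduced to the compact one by these operators. By commutation, a source is reduced by `T k`
alone, and a tight vertex, which is one where every `T k` gives `0`, by `e_i` alone. The three
claims about the graph follow. -/

namespace DescAbacus

/-! ### First-row coordinates and the tightening operators -/

section

variable {n ℓ : ℕ}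

theorem bead_antitone (ψ : DescAbacus n ℓ) (k : ℕ) : Antitone fun t => ψ.bead t k :=
  antitone_int_of_succ_le fun t => ψ.2 t k

theorem bead_strictAnti (ψ : DescAbacus n ℓ) (t : ℤ) : StrictAnti (ψ.bead t) := ψ.1.strictAnti t

theorem bead_periodic_mul (ψ : DescAbacus n ℓ) (t : ℤ) (k : ℕ) (m : ℤ) :
    ψ.bead (t + ℓ * m) k = ψ.bead t k - n * m := ψ.1.periodic_mul t k m

theorem ext_bead {ψ φ : DescAbacus n ℓ} (h : ∀ t k, ψ.bead t k = φ.bead t k) : ψ = φ :=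
  Subtype.ext (Abacus.ext (funext fun t => funext fun k => h t k))

/-- The first row on which the bead `k` is at position `v` or further to the left. -/
noncomputable def firstRow (ψ : DescAbacus n ℓ) (v : ℤ) (k : ℕ) : ℤ := sInf {t | ψ.bead t k ≤ v}

/-- The number of rows by which the beads `k` at the position `v + 1` can be moved down without
meeting the beads `k + 1`. -/
noncomputable def gap (ψ : DescAbacus n ℓ) (v : ℤ) (k : ℕ) : ℤ :=
  ψ.firstRow (v + 1) k - ψ.firstRow v (k + 1)

theorem T_eq_some_iff_bead {ψ χ : DescAbacus n ℓ} {k : ℕ} :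
    ψ.T k = some χ ↔
      ∀ t j, χ.bead t j = if j = k then ψ.bead (t + 1) j else ψ.bead t j := by
  unfold T
  split_ifs with h
  · rw [Option.some_inj]
    exact ⟨by rintro rfl t j; rfl, fun hχ => ext_bead fun t j => (hχ t j).symm⟩
  · simp only [false_iff]
    refine fun hχ => h fun t => ?_
    have := χ.bead_strictAnti t (Nat.lt_succ_self k)
    simpa [hχ] using this

/-- The guards in `T` and `Tstar` only say that the shifted rows are still strictly decreasing,
which is automatic once the result is a configuration. So the two operators are partial inverses,
and everything about `Tstar` reduces to `T`. -/
theorem Tstar_eq_some_iff {ψ χ : DescAbacus n ℓ} {k : ℕ} :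
    χ.Tstar k = some ψ ↔ ψ.T k = some χ := by
  have key : ψ.T k = some χ ↔
      ∀ t j, ψ.bead t j = if j = k then χ.bead (t + -1) j else χ.bead t j := by
    rw [T_eq_some_iff_bead]
    constructor <;> intro h t j <;> split_ifs with hj
    · rw [h, if_pos hj, neg_add_cancel_right]
    · rw [h, if_neg hj]
    · rw [h, if_pos hj, add_neg_cancel_right]
    · rw [h, if_neg hj]
  rw [key]
  unfold Tstar
  split_ifs with h
  · rw [Option.some_inj]
    exact ⟨by rintro rfl t j; rfl, fun hχ => ext_bead fun t j => (hχ t j).symm⟩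
  · simp only [false_iff]
    refine fun hχ => h fun t m hm => ?_
    have := ψ.bead_strictAnti t (show m < k by omega)
    rwa [hχ, hχ, if_pos rfl, if_neg (by omega)] at this

variable [NeZero n]

/-- The infimum is attained: periodicity with `n ≥ 1` makes the bead positions unbounded in both
directions along the rows. Through this Galois-type correspondence, `firstRow` carries the same
information as `bead`. -/
theorem firstRow_le_iff (ψ : DescAbacus n ℓ) {v : ℤ} {k : ℕ} {t : ℤ} :
    ψ.firstRow v k ≤ t ↔ ψ.bead t k ≤ v := by
  have hn : (1 : ℤ) ≤ n := by exact_mod_cast NeZero.one_le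
  have hne : {t | ψ.bead t k ≤ v}.Nonempty := by
    refine ⟨0 + ℓ * |ψ.bead 0 k - v|, ?_⟩
    have h1 := le_abs_self (ψ.bead 0 k - v)
    have h2 := abs_nonneg (ψ.bead 0 k - v)
    rw [Set.mem_ofPred_eq, bead_periodic_mul]
    nlinarith
  have hbd : BddBelow {t | ψ.bead t k ≤ v} := by
    refine ⟨0 + ℓ * (-(|ψ.bead 0 k - v| + 1)), fun s hs => ?_⟩
    have h1 := neg_abs_le (ψ.bead 0 k - v)
    have h2 := abs_nonneg (ψ.bead 0 k - v)
    by_contra! hlt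
    have h3 := ψ.bead_antitone k hlt.le
    simp only [bead_periodic_mul, Set.mem_ofPred_eq] at h3 hs
    nlinarith
  exact ⟨fun h => (ψ.bead_antitone k h).trans (Int.csInf_mem hne hbd), fun h => csInf_le hbd h⟩

theorem lt_firstRow_iff (ψ : DescAbacus n ℓ) {v : ℤ} {k : ℕ} {t : ℤ} :
    t < ψ.firstRow v k ↔ v < ψ.bead t k := by
  rw [← not_le, firstRow_le_iff, not_le]

theorem firstRow_anti (ψ : DescAbacus n ℓ) (k : ℕ) {v w : ℤ} (h : v ≤ w) :
    ψ.firstRow w k ≤ ψ.firstRow v k :=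
  ψ.firstRow_le_iff.2 ((ψ.firstRow_le_iff.1 le_rfl).trans h)

theorem firstRow_succ_le (ψ : DescAbacus n ℓ) (v : ℤ) (k : ℕ) :
    ψ.firstRow v (k + 1) ≤ ψ.firstRow (v + 1) k := by
  have h1 := ψ.firstRow_le_iff.1 (le_refl (ψ.firstRow (v + 1) k))
  have h2 := ψ.bead_strictAnti (ψ.firstRow (v + 1) k) (Nat.lt_succ_self k)
  rw [firstRow_le_iff]
  simp only [Nat.succ_eq_add_one] at h2
  omega

theorem gap_nonneg (ψ : DescAbacus n ℓ) (v : ℤ) (k : ℕ) : 0 ≤ ψ.gap v k :=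
  sub_nonneg.2 (ψ.firstRow_succ_le v k)

theorem firstRow_periodic_mul (ψ : DescAbacus n ℓ) (v : ℤ) (k : ℕ) (m : ℤ) :
    ψ.firstRow (v + n * m) k = ψ.firstRow v k - ℓ * m := by
  refine eq_of_forall_ge_iff fun t => ?_
  have := ψ.bead_periodic_mul t k m
  rw [firstRow_le_iff, sub_le_iff_le_add, firstRow_le_iff, this]
  omega

theorem ext_firstRow {ψ φ : DescAbacus n ℓ} (h : ∀ v k, ψ.firstRow v k = φ.firstRow v k) :
    ψ = φ :=
  ext_bead fun t k => eq_of_forall_ge_iff fun v => by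
    rw [← firstRow_le_iff, ← firstRow_le_iff, h]

theorem T_eq_some_iff {ψ χ : DescAbacus n ℓ} {k : ℕ} :
    ψ.T k = some χ ↔
      ∀ v j, χ.firstRow v j = ψ.firstRow v j - if j = k then 1 else 0 := by
  rw [T_eq_some_iff_bead]
  constructor
  · intro h v j
    refine eq_of_forall_ge_iff fun t => ?_
    rw [firstRow_le_iff, sub_le_iff_le_add, firstRow_le_iff, h]
    split_ifs <;> simp
  · intro h t j
    refine eq_of_forall_ge_iff fun v => ?_
    have := h v j
    split_ifs at this ⊢
    all_goals
      rw [← firstRow_le_iff, ← firstRow_le_iff]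
      omega

theorem T_eq_none_iff {ψ : DescAbacus n ℓ} {k : ℕ} : ψ.T k = none ↔ ∃ v, ψ.gap v k = 0 := by
  unfold T
  split_ifs with h
  · simp only [false_iff, not_exists]
    intro v hv
    have h1 := ψ.firstRow_le_iff.1 (le_refl (ψ.firstRow (v + 1) k))
    have h2 := h (ψ.firstRow (v + 1) k - 1)
    rw [sub_add_cancel] at h2
    have h3 : ψ.firstRow v (k + 1) ≤ ψ.firstRow (v + 1) k - 1 := ψ.firstRow_le_iff.2 (by omega)
    unfold gap at hv
    omega
  · simp only [true_iff]
    by_contra! hc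
    -- The gap to test is the one just left of the target position `ψ.bead (t + 1) k`.
    refine h fun t => ?_
    have h0 : ψ.bead (t + 1) k - 1 + 1 = ψ.bead (t + 1) k := by ring
    have h1 : ψ.firstRow (ψ.bead (t + 1) k - 1 + 1) k ≤ t + 1 := by rw [firstRow_le_iff, h0]
    have h2 := ψ.gap_nonneg (ψ.bead (t + 1) k - 1) k
    have h3 := hc (ψ.bead (t + 1) k - 1)
    unfold gap at h2 h3
    have h4 : ψ.firstRow (ψ.bead (t + 1) k - 1) (k + 1) ≤ t := by omega
    rw [firstRow_le_iff] at h4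
    omega

end

/-! ### The bracket word as a lattice path and its minima -/

section

variable {n ℓ : ℕ}

theorem f_eq_some_iff_val {ψ φ : DescAbacus n ℓ} {i : Fin n} :
    ψ.f i = some φ ↔ ψ.1.f i = some φ.1 := by
  unfold f
  refine Option.pmap_eq_some_iff.trans ?_
  constructor
  · rintro ⟨a, ha, h, rfl⟩
    exact h
  · exact fun h => ⟨φ.1, φ.2, h, rfl⟩

theorem e_eq_some_iff_val {ψ φ : DescAbacus n ℓ} {i : Fin n} :
    ψ.e i = some φ ↔ ψ.1.e i = some φ.1 := by
  unfold e
  refine Option.pmap_eq_some_iff.trans ?_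
  constructor
  · rintro ⟨a, ha, h, rfl⟩
    exact h
  · exact fun h => ⟨φ.1, φ.2, h, rfl⟩

open Classical in
/-- The number of beads at the position `i` minus the number of beads at the position `i + 1` on
the row `t`. -/
noncomputable def excess (ψ : DescAbacus n ℓ) (i t : ℤ) : ℤ :=
  (if ψ.1.Occupied t i then 1 else 0) - (if ψ.1.Occupied t (i + 1) then 1 else 0)

/-- The height, as a function of the place, of the lattice path which goes up at each `(` and down
at each `)`. -/
noncomputable def walk (ψ : DescAbacus n ℓ) (i x : ℤ) : ℤ :=
  ∑ j ∈ Finset.range x.toNat, ψ.excess i j -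
    ∑ j ∈ Finset.range (-x).toNat, ψ.excess i (-1 - j)

theorem walk_succ (ψ : DescAbacus n ℓ) (i x : ℤ) :
    ψ.walk i (x + 1) = ψ.walk i x + ψ.excess i x := by
  unfold walk
  rcases lt_or_ge x 0 with h | h
  · rw [Int.toNat_of_nonpos (by omega : x + 1 ≤ 0), Int.toNat_of_nonpos h.le,
      show (-x).toNat = (-(x + 1)).toNat + 1 by omega, Finset.sum_range_succ,
      show (-1 - ((-(x + 1)).toNat : ℤ)) = x by omega]
    ring
  · rw [Int.toNat_of_nonpos (by omega : -(x + 1) ≤ 0), Int.toNat_of_nonpos (by omega : -x ≤ 0),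
      show (x + 1).toNat = x.toNat + 1 by omega, Finset.sum_range_succ, Int.toNat_of_nonneg h]
    ring

theorem sum_excess_Ico (ψ : DescAbacus n ℓ) (i : ℤ) {x y : ℤ} (h : x ≤ y) :
    ∑ t ∈ Finset.Ico x y, ψ.excess i t = ψ.walk i y - ψ.walk i x := by
  induction y, h using Int.leInduction with
  | base => simp
  | succ y hxy ih =>
    have : Finset.Ico x (y + 1) = insert y (Finset.Ico x y) := by
      ext z
      simp only [Finset.mem_Ico, Finset.mem_insert]
      omega
    rw [this, Finset.sum_insert (by simp), ih, walk_succ]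
    ring

theorem numOpen_sub_numClose (ψ : DescAbacus n ℓ) (i : Fin n) (s : Finset ℤ) :
    (ψ.1.numOpen i s : ℤ) - ψ.1.numClose i s = ∑ t ∈ s, ψ.excess i t := by
  classical
  unfold Abacus.numOpen Abacus.numClose
  rw [Finset.card_filter, Finset.card_filter]
  push_cast
  rw [← Finset.sum_sub_distrib]
  refine Finset.sum_congr rfl fun t _ => ?_
  simp only [Abacus.hasOpen_iff, Abacus.hasClose_iff, excess]
  by_cases h1 : ψ.1.Occupied t i <;> by_cases h2 : ψ.1.Occupied t (i + 1) <;> simp [h1, h2]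

theorem hasOpen_iff_excess (ψ : DescAbacus n ℓ) (i : Fin n) (t : ℤ) :
    ψ.1.HasOpen i t ↔ 1 ≤ ψ.excess i t := by
  simp only [Abacus.hasOpen_iff, excess]
  by_cases h1 : ψ.1.Occupied t i <;> by_cases h2 : ψ.1.Occupied t (i + 1) <;> simp [h1, h2]

theorem hasClose_iff_excess (ψ : DescAbacus n ℓ) (i : Fin n) (t : ℤ) :
    ψ.1.HasClose i t ↔ ψ.excess i t ≤ -1 := by
  simp only [Abacus.hasClose_iff, excess]
  by_cases h1 : ψ.1.Occupied t i <;> by_cases h2 : ψ.1.Occupied t (i + 1) <;> simp [h1, h2]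

/-- An uncanceled `(` is an up-step from a height to which the path never returns. The strict
inequality at `u = t + 1` already encodes the presence of the bracket. -/
theorem uncanceledOpen_iff_walk (ψ : DescAbacus n ℓ) (i : Fin n) (t : ℤ) :
    ψ.1.UncanceledOpen i t ↔ ∀ u, t < u → ψ.walk i t < ψ.walk i u := by
  have key : ∀ u, t ≤ u → ((ψ.1.numOpen i (Finset.Ioc t u) : ℤ) - ψ.1.numClose i (Finset.Ioc t u)
      = ψ.walk i (u + 1) - ψ.walk i (t + 1)) := fun u hu => by
    rw [numOpen_sub_numClose, ← sum_excess_Ico _ _ (by omega)]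
    refine Finset.sum_congr ?_ fun _ _ => rfl
    ext z
    simp only [Finset.mem_Ico, Finset.mem_Ioc]
    omega
  have hs := ψ.walk_succ i t
  unfold Abacus.UncanceledOpen
  rw [hasOpen_iff_excess]
  constructor
  · rintro ⟨h1, h2⟩ u hu
    have h3 := key (u - 1) (by omega)
    have h4 := h2 (u - 1)
    rw [sub_add_cancel] at h3
    omega
  · intro h
    refine ⟨?_, fun u => ?_⟩
    · have := h (t + 1) (by omega)
      omega
    · rcases le_or_gt u t with hu | hu
      · rw [Finset.Ioc_eq_empty (by omega)]
        simp [Abacus.numOpen, Abacus.numClose]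
      · have h3 := key u hu.le
        have h4 := h (u + 1) (by omega)
        have h5 : ψ.excess i t ≤ 1 := by
          unfold excess
          split_ifs <;> simp
        omega

theorem uncanceledClose_iff_walk (ψ : DescAbacus n ℓ) (i : Fin n) (t : ℤ) :
    ψ.1.UncanceledClose i t ↔ ∀ u, u ≤ t → ψ.walk i (t + 1) < ψ.walk i u := by
  have key : ∀ u, u ≤ t → ((ψ.1.numOpen i (Finset.Ico u t) : ℤ) - ψ.1.numClose i (Finset.Ico u t)
      = ψ.walk i t - ψ.walk i u) := fun u hu => by
    rw [numOpen_sub_numClose, ← sum_excess_Ico _ _ hu]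
  have hs := ψ.walk_succ i t
  unfold Abacus.UncanceledClose
  rw [hasClose_iff_excess]
  constructor
  · rintro ⟨h1, h2⟩ u hu
    have h3 := key u hu
    have h4 := h2 u
    omega
  · intro h
    refine ⟨?_, fun u => ?_⟩
    · have := h t le_rfl
      omega
    · rcases lt_or_ge t u with hu | hu
      · rw [Finset.Ico_eq_empty (by omega)]
        simp [Abacus.numOpen, Abacus.numClose]
      · have h3 := key u hu
        have h4 := h u hu
        have h5 : -1 ≤ ψ.excess i t := by
          unfold excess
          split_ifs <;> simp
        omega

variable [NeZero n]

theorem occupied_iff_firstRow (ψ : DescAbacus n ℓ) (t v : ℤ) :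
    ψ.1.Occupied t v ↔ ∃ j, ψ.firstRow v j ≤ t ∧ t < ψ.firstRow (v - 1) j := by
  refine exists_congr fun j => ?_
  rw [firstRow_le_iff, lt_firstRow_iff]
  show ψ.bead t j = v ↔ _
  omega

theorem firstRow_le_of_lt (ψ : DescAbacus n ℓ) (v : ℤ) {j k : ℕ} (h : j < k) :
    ψ.firstRow (v - 1) k ≤ ψ.firstRow v j := by
  rw [firstRow_le_iff]
  have h1 := ψ.firstRow_le_iff.1 (le_refl (ψ.firstRow v j))
  have h2 := ψ.bead_strictAnti (ψ.firstRow v j) h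
  omega

theorem firstRow_antitone_right (ψ : DescAbacus n ℓ) (v : ℤ) : Antitone (ψ.firstRow v) :=
  fun _ _ h => ψ.firstRow_le_iff.2
    (((ψ.bead_strictAnti _).antitone h).trans (ψ.firstRow_le_iff.1 le_rfl))

/-- On such a row bead `m` is to the right of `i` and bead `m + 1` is not, so only bead `m + 1` can
be at `i` and only bead `m` at `i + 1`. -/
theorem excess_of_mem (ψ : DescAbacus n ℓ) (i : ℤ) (m : ℕ) {t : ℤ}
    (h1 : ψ.firstRow i (m + 1) ≤ t) (h2 : t < ψ.firstRow i m) :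
    ψ.excess i t = (if t < ψ.firstRow (i - 1) (m + 1) then 1 else 0) -
      (if ψ.firstRow (i + 1) m ≤ t then 1 else 0) := by
  have h3 : ψ.1.Occupied t i ↔ t < ψ.firstRow (i - 1) (m + 1) := by
    rw [occupied_iff_firstRow]
    refine ⟨?_, fun h => ⟨m + 1, h1, h⟩⟩
    rintro ⟨j, hj1, hj2⟩
    rcases lt_trichotomy j (m + 1) with hj | rfl | hj
    · have := ψ.firstRow_antitone_right i (show j ≤ m by omega)
      omega
    · exact hj2
    · have := ψ.firstRow_le_of_lt i hj
      omega
  have h4 : ψ.1.Occupied t (i + 1) ↔ ψ.firstRow (i + 1) m ≤ t := by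
    rw [occupied_iff_firstRow, add_sub_cancel_right]
    refine ⟨?_, fun h => ⟨m, h, h2⟩⟩
    rintro ⟨j, hj1, hj2⟩
    rcases lt_trichotomy j m with hj | rfl | hj
    · have := ψ.firstRow_le_of_lt (i + 1) hj
      rw [add_sub_cancel_right] at this
      omega
    · exact hj1
    · have := ψ.firstRow_antitone_right i (show m + 1 ≤ j by omega)
      omega
  unfold excess
  simp only [h3, h4]

theorem excess_of_le (ψ : DescAbacus n ℓ) (i : ℤ) {t : ℤ} (h1 : ψ.firstRow i 0 ≤ t) :
    ψ.excess i t = if t < ψ.firstRow (i - 1) 0 then 1 else 0 := by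
  have h3 : ψ.1.Occupied t i ↔ t < ψ.firstRow (i - 1) 0 := by
    rw [occupied_iff_firstRow]
    refine ⟨?_, fun h => ⟨0, h1, h⟩⟩
    rintro ⟨j, hj1, hj2⟩
    rcases Nat.eq_zero_or_pos j with rfl | hj
    · exact hj2
    · have := ψ.firstRow_le_of_lt i hj
      omega
  have h4 : ¬ ψ.1.Occupied t (i + 1) := by
    rw [occupied_iff_firstRow, add_sub_cancel_right]
    rintro ⟨j, hj1, hj2⟩
    have := ψ.firstRow_antitone_right i (Nat.zero_le j)
    omega
  unfold excess
  simp only [h3, h4, if_false, sub_zero]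

/-- The first parenthesis counts the rows with bead `m + 1` at `i`, the second those with bead `m`
at `i + 1`. The former are at the start of the interval and the latter at its end, so the path has
no interior dip. -/
theorem walk_of_mem (ψ : DescAbacus n ℓ) (i : ℤ) (m : ℕ) {u : ℤ}
    (h1 : ψ.firstRow i (m + 1) ≤ u) (h2 : u ≤ ψ.firstRow i m) :
    ψ.walk i u = ψ.walk i (ψ.firstRow i (m + 1)) +
      (min u (ψ.firstRow (i - 1) (m + 1)) - ψ.firstRow i (m + 1)) -
      (u - min u (ψ.firstRow (i + 1) m)) := by
  have h3 := ψ.firstRow_anti (m + 1) (show i - 1 ≤ i by omega)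
  have h4 := ψ.firstRow_succ_le i m
  induction u, h1 using Int.leInduction with
  | base => omega
  | succ u hu ih =>
    rw [walk_succ, ih (by omega), ψ.excess_of_mem i m hu (by omega)]
    split_ifs <;> omega

theorem walk_of_le (ψ : DescAbacus n ℓ) (i : ℤ) {u : ℤ} (h1 : ψ.firstRow i 0 ≤ u) :
    ψ.walk i u = ψ.walk i (ψ.firstRow i 0) +
      (min u (ψ.firstRow (i - 1) 0) - ψ.firstRow i 0) := by
  have h3 := ψ.firstRow_anti 0 (show i - 1 ≤ i by omega)
  induction u, h1 using Int.leInduction with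
  | base => omega
  | succ u hu ih =>
    rw [walk_succ, ih, ψ.excess_of_le i hu]
    split_ifs <;> omega

/-- The height of the path at the place where the bracket sequence of the bead `m` changes from
`)` to `(`, relative to that for `m = 0`. -/
noncomputable def potential (ψ : DescAbacus n ℓ) (i : ℤ) (m : ℕ) : ℤ :=
  ∑ j ∈ Finset.range m, (ψ.gap (i - 1) j - ψ.gap i j)

omit [NeZero n] in
theorem potential_succ (ψ : DescAbacus n ℓ) (i : ℤ) (m : ℕ) :
    ψ.potential i (m + 1) = ψ.potential i m + (ψ.gap (i - 1) m - ψ.gap i m) :=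
  Finset.sum_range_succ _ _

theorem walk_firstRow (ψ : DescAbacus n ℓ) (i : ℤ) (m : ℕ) :
    ψ.walk i (ψ.firstRow i m) = ψ.walk i (ψ.firstRow i 0) + ψ.potential i m := by
  induction m with
  | zero => simp [potential]
  | succ m ih =>
    have h1 := ψ.firstRow_antitone_right i (Nat.le_succ m)
    have h2 := ψ.walk_of_mem i m h1 le_rfl
    have h3 := ψ.firstRow_anti m (show i ≤ i + 1 by omega)
    have h4 := ψ.firstRow_le_of_lt i (Nat.lt_succ_self m)
    rw [potential_succ, gap, gap, sub_add_cancel]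
    simp only [Nat.succ_eq_add_one] at *
    omega

omit [NeZero n] in
theorem charge_eq (ψ : DescAbacus n ℓ) {t c : ℤ} (h : ∀ᶠ j : ℕ in atTop, ψ.bead t j = c - j) :
    ψ.1.charge t = c := by
  obtain ⟨j, h1, h2⟩ := ((ψ.1.charge_spec t).and h).exists
  unfold bead at h2
  omega

/-- On all rows, the beads from the `N`-th on are packed. -/
theorem exists_packed (ψ : DescAbacus n ℓ) :
    ∃ N, ∀ t j, N ≤ j → ψ.bead t j = ψ.1.charge t - j := by
  -- With `ℓ = 0` periodicity would force `n = 0`. Positivity of `ℓ` reduces the uniform bound to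
  -- finitely many rows.
  have hℓ : 0 < ℓ := by
    by_contra! h0
    have h1 := ψ.1.periodic 0 0
    have h2 := NeZero.ne n
    obtain rfl : ℓ = 0 := by omega
    simp at h1
    omega
  have h : ∀ᶠ j : ℕ in atTop, ∀ r ∈ Finset.range ℓ, ψ.bead r j = ψ.1.charge r - j :=
    (Filter.eventually_all_finset _).2 fun r _ => ψ.1.charge_spec r
  obtain ⟨N, hN⟩ := eventually_atTop.1 h
  refine ⟨N, fun t => ?_⟩
  have hr : (t % ℓ).toNat ∈ Finset.range ℓ := by
    have := Int.emod_lt_of_pos t (show (0 : ℤ) < ℓ by omega)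
    simp
    omega
  have hr' : (((t % ℓ).toNat : ℕ) : ℤ) = t % ℓ :=
    Int.toNat_of_nonneg (Int.emod_nonneg _ (by omega))
  have hb : ∀ j, N ≤ j → ψ.bead t j = ψ.1.charge (t % ℓ) - n * (t / ℓ) - j := fun j hj => by
    have h1 := hN j hj _ hr
    have h2 := ψ.bead_periodic_mul (t % ℓ) j (t / ℓ)
    rw [hr'] at h1
    rw [Int.emod_add_mul_ediv] at h2
    linarith
  intro j hj
  rw [ψ.charge_eq (eventually_atTop.2 ⟨N, hb⟩), hb j hj]

theorem gap_eq_zero_of_bead_succ (ψ : DescAbacus n ℓ) {k : ℕ}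
    (h : ∀ t, ψ.bead t (k + 1) = ψ.bead t k - 1) (v : ℤ) : ψ.gap v k = 0 := by
  refine sub_eq_zero.2 (eq_of_forall_ge_iff fun t => ?_)
  rw [firstRow_le_iff, firstRow_le_iff, h]
  omega

theorem exists_gap_eq_zero (ψ : DescAbacus n ℓ) : ∃ N, ∀ m, N ≤ m → ∀ v, ψ.gap v m = 0 := by
  obtain ⟨N, hN⟩ := ψ.exists_packed
  refine ⟨N, fun m hm => ψ.gap_eq_zero_of_bead_succ fun t => ?_⟩
  rw [hN t m hm, hN t (m + 1) (by omega)]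
  push_cast
  ring

theorem exists_firstRow_le (ψ : DescAbacus n ℓ) (i x : ℤ) : ∃ m, ψ.firstRow i m ≤ x := by
  simp only [firstRow_le_iff]
  have h : ∀ m : ℕ, ψ.bead x m ≤ ψ.bead x 0 - m := fun m => by
    induction m with
    | zero => simp
    | succ m ih =>
      have := ψ.bead_strictAnti x (Nat.lt_succ_self m)
      push_cast
      simp only [Nat.succ_eq_add_one] at this
      omega
  refine ⟨(ψ.bead x 0 - i).toNat, ?_⟩
  have := h (ψ.bead x 0 - i).toNat
  omega

/-- Each place is to the right of all the places `firstRow i m`, or between two consecutive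
ones. -/
theorem exists_mem_firstRow (ψ : DescAbacus n ℓ) (i x : ℤ) :
    ψ.firstRow i 0 ≤ x ∨ ∃ m, ψ.firstRow i (m + 1) ≤ x ∧ x < ψ.firstRow i m := by
  classical
  have h := ψ.exists_firstRow_le i x
  rcases hm : Nat.find h with _ | m
  · exact Or.inl (hm ▸ Nat.find_spec h)
  · exact Or.inr ⟨m, hm ▸ Nat.find_spec h, not_le.1 (Nat.find_min h (by omega))⟩

/-- The function `y` has its minimum at `K` and at no earlier place. -/
def IsFirstMin (y : ℕ → ℤ) (K : ℕ) : Prop := (∀ m, y K ≤ y m) ∧ ∀ m, m < K → y K < y m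

/-- The function `y` has its minimum at `K` and at no later place. -/
def IsLastMin (y : ℕ → ℤ) (K : ℕ) : Prop := (∀ m, y K ≤ y m) ∧ ∀ m, K < m → y K < y m

theorem exists_isFirstMin {y : ℕ → ℤ} {N : ℕ} (h : ∀ m, N ≤ m → y m = y N) :
    ∃ K, IsFirstMin y K := by
  classical
  have h0 : ∃ K, ∀ m, y K ≤ y m := by
    obtain ⟨K, -, hK⟩ := Finset.exists_min_image (Finset.range (N + 1)) y ⟨0, by simp⟩
    refine ⟨K, fun m => ?_⟩
    rcases le_total m N with hm | hm
    · exact hK m (by simp; omega)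
    · rw [h m hm]
      exact hK N (by simp)
  refine ⟨Nat.find h0, Nat.find_spec h0, fun m hm => ?_⟩
  have h1 := Nat.find_min h0 hm
  push Not at h1
  obtain ⟨k, hk⟩ := h1
  have := Nat.find_spec h0 k
  omega

/-- If the minimum were attained on the constant tail there would be no last minimizer; this is the
case in which `e_i` gives `0`. -/
theorem exists_isLastMin {y : ℕ → ℤ} {N K : ℕ} (h : ∀ m, N ≤ m → y m = y N) (hK : y K < y N) :
    ∃ K, IsLastMin y K := by
  classical
  obtain ⟨L, hL⟩ := exists_isFirstMin h
  have hlt : ∀ m, (∀ k, y m ≤ y k) → m ≤ N := fun m hm => by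
    by_contra! hc
    have := h m hc.le
    have := hm K
    omega
  have hs := Nat.findGreatest_spec (P := fun m => ∀ k, y m ≤ y k) (hlt L hL.1) hL.1
  refine ⟨_, hs, fun m hm => ?_⟩
  by_contra! hc
  have h1 : ∀ k, y m ≤ y k := fun k => hc.trans (hs k)
  have := Nat.le_findGreatest (P := fun m => ∀ k, y m ≤ y k) (hlt m h1) h1
  omega

theorem potential_eventually (ψ : DescAbacus n ℓ) :
    ∃ N, ∀ i m, N ≤ m → ψ.potential i m = ψ.potential i N := by
  obtain ⟨N, hN⟩ := ψ.exists_gap_eq_zero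
  refine ⟨N, fun i m hm => ?_⟩
  induction m, hm using Nat.le_induction with
  | base => rfl
  | succ m hm ih => rw [potential_succ, ih, hN m hm, hN m hm, sub_zero, add_zero]

theorem walk_le_walk (ψ : DescAbacus n ℓ) (i : ℤ) {K : ℕ}
    (h : ∀ m, ψ.potential i K ≤ ψ.potential i m) (u : ℤ) :
    ψ.walk i (ψ.firstRow i K) ≤ ψ.walk i u := by
  have hK := ψ.walk_firstRow i K
  rcases ψ.exists_mem_firstRow i u with hu | ⟨m, hu1, hu2⟩
  · have h1 := ψ.walk_of_le i hu
    have h2 := h 0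
    have h3 := ψ.firstRow_anti 0 (show i - 1 ≤ i by omega)
    have h4 := ψ.walk_firstRow i 0
    omega
  · have h1 := ψ.walk_of_mem i m hu1 hu2.le
    have h2 := h m
    have h3 := h (m + 1)
    have h4 := ψ.walk_firstRow i m
    have h5 := ψ.walk_firstRow i (m + 1)
    have h6 := ψ.walk_of_mem i m (hu1.trans hu2.le) le_rfl
    have h7 := ψ.firstRow_anti (m + 1) (show i - 1 ≤ i by omega)
    have h8 := ψ.firstRow_succ_le i m
    omega

/-- The rows `firstRow i m` decrease with `m`, so the smallest minimizer gives the rightmost minimum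
of the path. The extra inequality matters only for `K = 0`, where the path might stay flat to the
right of this row. -/
theorem isLeast_uncanceledOpen (ψ : DescAbacus n ℓ) (i : Fin n) {K : ℕ}
    (h : IsFirstMin (ψ.potential i) K) (hK : ψ.firstRow i K < ψ.firstRow (i - 1) K) :
    IsLeast {t | ψ.1.UncanceledOpen i t} (ψ.firstRow i K) := by
  have hW := ψ.walk_firstRow i K
  constructor
  · rw [Set.mem_ofPred_eq, uncanceledOpen_iff_walk]
    intro u hu
    rcases ψ.exists_mem_firstRow i (u - 1) with hu' | ⟨m, hu1, hu2⟩
    · have h1 := ψ.walk_of_le i (u := u) (by omega)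
      have h4 := ψ.walk_firstRow i 0
      rcases Nat.eq_zero_or_pos K with rfl | h0
      · omega
      · have h2 := h.2 0 h0
        have h3 := ψ.firstRow_anti 0 (show (i : ℤ) - 1 ≤ i by omega)
        omega
    · have hm : m < K := by
        by_contra! hm
        have := ψ.firstRow_antitone_right i hm
        omega
      have h1 := ψ.walk_of_mem i m (u := u) (by omega) (by omega)
      have h2 := h.2 m hm
      have h3 := h.1 (m + 1)
      have h4 := ψ.walk_firstRow i m
      have h5 := ψ.walk_firstRow i (m + 1)
      have h6 := ψ.walk_of_mem i m (u := ψ.firstRow i m) (by omega) le_rfl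
      have h7 := ψ.firstRow_anti (m + 1) (show (i : ℤ) - 1 ≤ i by omega)
      have h8 := ψ.firstRow_succ_le i m
      omega
  · intro t ht
    rw [Set.mem_ofPred_eq, uncanceledOpen_iff_walk] at ht
    by_contra! hlt
    have h1 := ht _ hlt
    have h2 := ψ.walk_le_walk i h.1 t
    omega

/-- The largest minimizer gives the leftmost minimum of the path; the down-step into it starts one
row earlier, hence the `- 1`. -/
theorem isGreatest_uncanceledClose (ψ : DescAbacus n ℓ) (i : Fin n) {K : ℕ}
    (h : IsLastMin (ψ.potential i) K) :
    IsGreatest {t | ψ.1.UncanceledClose i t} (ψ.firstRow i K - 1) := by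
  have hW := ψ.walk_firstRow i K
  constructor
  · rw [Set.mem_ofPred_eq, uncanceledClose_iff_walk, sub_add_cancel]
    intro u hu
    rcases ψ.exists_mem_firstRow i u with hu' | ⟨m, hu1, hu2⟩
    · have := ψ.firstRow_antitone_right i (Nat.zero_le K)
      omega
    · have hm : K < m + 1 := by
        by_contra! hm
        have := ψ.firstRow_antitone_right i hm
        omega
      have h1 := ψ.walk_of_mem i m hu1 hu2.le
      have h2 := h.2 (m + 1) hm
      have h3 := h.1 m
      have h4 := ψ.walk_firstRow i m
      have h5 := ψ.walk_firstRow i (m + 1)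
      have h6 := ψ.walk_of_mem i m (u := ψ.firstRow i m) (by omega) le_rfl
      have h7 := ψ.firstRow_anti (m + 1) (show (i : ℤ) - 1 ≤ i by omega)
      have h8 := ψ.firstRow_succ_le i m
      omega
  · intro t ht
    rw [Set.mem_ofPred_eq, uncanceledClose_iff_walk] at ht
    by_contra! hlt
    have h1 := ht (ψ.firstRow i K) (by omega)
    have h2 := ψ.walk_le_walk i h.1 (t + 1)
    omega

theorem exists_isFirstMin_of_uncanceledOpen (ψ : DescAbacus n ℓ) (i : Fin n) {t : ℤ}
    (ht : ψ.1.UncanceledOpen i t) :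
    ∃ K, IsFirstMin (ψ.potential i) K ∧ ψ.firstRow i K < ψ.firstRow (i - 1) K := by
  obtain ⟨N, hN⟩ := ψ.potential_eventually
  obtain ⟨K, hK⟩ := exists_isFirstMin (hN i)
  refine ⟨K, hK, ?_⟩
  rcases Nat.eq_zero_or_pos K with rfl | h0
  -- Otherwise the path is constant, at its minimum, from `firstRow i 0` on, so no later height can
  -- exceed the one at `t`.
  · by_contra! hle
    rw [uncanceledOpen_iff_walk] at ht
    have h1 := ht (max (t + 1) (ψ.firstRow i 0)) (by omega)
    have h2 := ψ.walk_of_le i (le_max_right (t + 1) (ψ.firstRow i 0))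
    have h3 := ψ.firstRow_anti 0 (show (i : ℤ) - 1 ≤ i by omega)
    have h4 := ψ.walk_le_walk i hK.1 t
    omega
  · obtain ⟨m, rfl⟩ := Nat.exists_eq_add_of_lt h0
    rw [zero_add] at hK ⊢
    -- The potential drops strictly from `m` to `m + 1`, so the path rises on the way from `firstRow
    -- i (m + 1)` to `firstRow i m`, which requires a row with bead `m + 1` at `i`.
    have h1 := hK.2 m (Nat.lt_succ_self m)
    have h2 := ψ.firstRow_anti m (show (i : ℤ) ≤ i + 1 by omega)
    rw [potential_succ, gap, gap, sub_add_cancel] at h1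
    omega

theorem exists_isLastMin_of_uncanceledClose (ψ : DescAbacus n ℓ) (i : Fin n) {t : ℤ}
    (ht : ψ.1.UncanceledClose i t) : ∃ K, IsLastMin (ψ.potential i) K := by
  obtain ⟨N, hN⟩ := ψ.potential_eventually
  obtain ⟨K, hK⟩ := exists_isFirstMin (hN i)
  refine exists_isLastMin (hN i) (K := K) ?_
  -- A low point left of `t` with index at least `N` has the tail height, and the uncanceled `)`
  -- brings the path strictly below it.
  obtain ⟨m, hm⟩ := ψ.exists_firstRow_le i t
  have h1 := ψ.firstRow_antitone_right i (le_max_left m N)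
  have h2 := (ψ.uncanceledClose_iff_walk i t).1 ht _ (h1.trans hm)
  have h3 := ψ.walk_le_walk i hK.1 (t + 1)
  have h4 := hN i _ (le_max_right m N)
  have h5 := ψ.walk_firstRow i K
  have h6 := ψ.walk_firstRow i (max m N)
  omega

end

/-! ### The operators `f_i` and `e_i` in first-row coordinates -/

section

variable {n ℓ : ℕ}

theorem exists_f_eq_some (ψ : DescAbacus n ℓ) {i : Fin n} {t : ℤ}
    (ht : IsLeast {t | ψ.1.UncanceledOpen i t} t) :
    ∃ j φ, ψ.f i = some φ ∧ ψ.bead t j = i ∧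
      ∀ s k, φ.bead s k = ψ.bead s k + if k = j ∧ (ℓ : ℤ) ∣ s - t then 1 else 0 := by
  have h : ∃ t, IsLeast {t | ψ.1.UncanceledOpen i t} t := ⟨t, ht⟩
  have he : ψ.1.f i = some (ψ.1.move (Abacus.placeRow ℓ h.choose)
      h.choose_spec.1.1.exists_bead.choose 1 (Or.inl rfl)
      h.choose_spec.1.1.exists_bead.choose_spec.2) := by
    unfold Abacus.f
    rw [dif_pos h]
  have hc : h.choose = t := h.choose_spec.unique ht
  refine ⟨h.choose_spec.1.1.exists_bead.choose, ⟨_, ψ.2.f he⟩, f_eq_some_iff_val.2 he, ?_, ?_⟩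
  · have h1 := h.choose_spec.1.1.exists_bead.choose_spec.1
    rw [← hc]
    have h2 := ψ.1.bead_place h.choose h.choose_spec.1.1.exists_bead.choose
    have h3 : Abacus.placeGap ℓ i h.choose = i + n * (h.choose / ℓ) := rfl
    rw [h1] at h2
    unfold bead
    linarith
  · intro s k
    show (_ + _ : ℤ) = _
    simp only [Abacus.dvd_sub_placeRow, hc]
    rfl

theorem exists_e_eq_some (ψ : DescAbacus n ℓ) {i : Fin n} {t : ℤ}
    (ht : IsGreatest {t | ψ.1.UncanceledClose i t} t) :
    ∃ j φ, ψ.e i = some φ ∧ ψ.bead t j = i + 1 ∧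
      ∀ s k, φ.bead s k = ψ.bead s k + if k = j ∧ (ℓ : ℤ) ∣ s - t then -1 else 0 := by
  have h : ∃ t, IsGreatest {t | ψ.1.UncanceledClose i t} t := ⟨t, ht⟩
  have he : ψ.1.e i = some (ψ.1.move (Abacus.placeRow ℓ h.choose)
      h.choose_spec.1.1.exists_bead.choose (-1) (Or.inr rfl)
      h.choose_spec.1.1.exists_bead.choose_spec.2) := by
    unfold Abacus.e
    rw [dif_pos h]
  have hc : h.choose = t := h.choose_spec.unique ht
  refine ⟨h.choose_spec.1.1.exists_bead.choose, ⟨_, ψ.2.e he⟩, e_eq_some_iff_val.2 he, ?_, ?_⟩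
  · have h1 := h.choose_spec.1.1.exists_bead.choose_spec.1
    rw [← hc]
    have h2 := ψ.1.bead_place h.choose h.choose_spec.1.1.exists_bead.choose
    have h3 : Abacus.placeGap ℓ i h.choose = i + n * (h.choose / ℓ) := rfl
    rw [h1] at h2
    unfold bead
    linarith
  · intro s k
    show (_ + _ : ℤ) = _
    simp only [Abacus.dvd_sub_placeRow, hc]
    rfl

theorem exists_uncanceledOpen {ψ φ : DescAbacus n ℓ} {i : Fin n} (h : ψ.f i = some φ) :
    ∃ t, ψ.1.UncanceledOpen i t := by
  rw [f_eq_some_iff_val, Abacus.f] at h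
  split_ifs at h with ht
  exact ht.imp fun _ h => h.1

theorem exists_uncanceledClose {ψ φ : DescAbacus n ℓ} {i : Fin n} (h : ψ.e i = some φ) :
    ∃ t, ψ.1.UncanceledClose i t := by
  rw [e_eq_some_iff_val, Abacus.e] at h
  split_ifs at h with ht
  exact ht.imp fun _ h => h.1

/-- The change of the first rows under a move of bead `K` from `i` to `i + 1`. -/
def bump (n : ℕ) (i : ℤ) (K : ℕ) (v : ℤ) (k : ℕ) : ℤ := if k = K ∧ (n : ℤ) ∣ v - i then 1 else 0

variable [NeZero n]

/-- The moved bead is the first one at `i`, so after the move the row `firstRow i K` no longer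
qualifies and the next row does. The periodic copies of the bead do the same for every `v` congruent
to `i` modulo `n`. -/
theorem firstRow_of_move_right {ψ φ : DescAbacus n ℓ} {i : ℤ} {K : ℕ}
    (hK : ψ.firstRow i K < ψ.firstRow (i - 1) K)
    (h : ∀ s k, φ.bead s k = ψ.bead s k +
      if k = K ∧ (ℓ : ℤ) ∣ s - ψ.firstRow i K then 1 else 0) (v : ℤ) (k : ℕ) :
    φ.firstRow v k = ψ.firstRow v k + bump n i K v k := by
  refine eq_of_forall_ge_iff fun s => ?_
  unfold bump
  by_cases hk : k = K
  swap
  · simp only [hk, false_and, if_false, add_zero]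
    rw [firstRow_le_iff, firstRow_le_iff, h, if_neg (by tauto), add_zero]
  subst hk
  have hb : ψ.bead (ψ.firstRow i k) k = i := by
    have h1 := ψ.firstRow_le_iff.1 (le_refl (ψ.firstRow i k))
    have h2 := ψ.lt_firstRow_iff.1 hK
    omega
  simp only [true_and]
  rw [firstRow_le_iff, h]
  simp only [true_and]
  by_cases hv : (n : ℤ) ∣ v - i
  · obtain ⟨m, hm⟩ := hv
    have hvm : v = i + n * m := by linarith
    have h1 := ψ.firstRow_periodic_mul i k m
    have h2 := ψ.bead_periodic_mul (ψ.firstRow i k) k (-m)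
    rw [if_pos (show (n : ℤ) ∣ v - i from ⟨m, hm⟩)]
    rw [← hvm] at h1
    rw [show ψ.firstRow i k + ℓ * -m = ψ.firstRow v k by rw [h1]; ring, hb,
      show i - (n : ℤ) * -m = v by rw [hvm]; ring] at h2
    rcases lt_trichotomy s (ψ.firstRow v k) with hs | rfl | hs
    · have := ψ.lt_firstRow_iff.1 hs
      split_ifs <;> omega
    · rw [if_pos (show (ℓ : ℤ) ∣ _ from ⟨-m, by rw [h1]; ring⟩)]
      omega
    · have h3 := ψ.firstRow_le_iff.1 hs.le
      split_ifs with hd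
      · have h4 : ψ.bead s k ≠ v := by
          obtain ⟨m', hm'⟩ := hd
          have h5 := ψ.bead_periodic_mul (ψ.firstRow i k) k m'
          rw [show ψ.firstRow i k + (ℓ : ℤ) * m' = s by linarith, hb] at h5
          intro h6
          have h7 : (n : ℤ) * (m + m') = 0 := by linarith
          have h8 : m' = -m := by
            have := (mul_eq_zero.1 h7).resolve_left (by exact_mod_cast NeZero.ne n)
            omega
          subst h8
          have : (ℓ : ℤ) * -m = -(ℓ * m) := by ring
          omega
        omega
      · omega
  · rw [if_neg hv, add_zero, firstRow_le_iff]
    split_ifs with hd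
    · have h4 : ψ.bead s k ≠ v := by
        obtain ⟨m', hm'⟩ := hd
        have h5 := ψ.bead_periodic_mul (ψ.firstRow i k) k m'
        rw [show ψ.firstRow i k + (ℓ : ℤ) * m' = s by linarith, hb] at h5
        exact fun h6 => hv ⟨-m', by linarith⟩
      omega
    · rw [add_zero]

theorem firstRow_of_move_left {ψ φ : DescAbacus n ℓ} {i : ℤ} {K : ℕ}
    (hb : ψ.bead (ψ.firstRow i K - 1) K = i + 1)
    (h : ∀ s k, φ.bead s k = ψ.bead s k +
      if k = K ∧ (ℓ : ℤ) ∣ s - (ψ.firstRow i K - 1) then -1 else 0) (v : ℤ) (k : ℕ) :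
    φ.firstRow v k = ψ.firstRow v k - bump n i K v k := by
  -- Once this is known, `ψ` arises from `φ` by a move to the right, and the previous lemma applies.
  have hK : φ.firstRow i K = ψ.firstRow i K - 1 := by
    refine le_antisymm ?_ ?_
    · rw [firstRow_le_iff, h, hb, if_pos ⟨rfl, by simp⟩]
      omega
    · by_contra! hlt
      have h1 := φ.firstRow_le_iff.1 (show φ.firstRow i K ≤ ψ.firstRow i K - 1 - 1 by omega)
      have h2 := ψ.bead_antitone K (show ψ.firstRow i K - 1 - 1 ≤ ψ.firstRow i K - 1 by omega)
      simp only [hb] at h2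
      rw [h] at h1
      split_ifs at h1 with hd
      · have h3 : ψ.bead (ψ.firstRow i K - 1 - 1) K = i + 1 := by omega
        obtain ⟨m, hm⟩ := hd.2
        have h5 := ψ.bead_periodic_mul (ψ.firstRow i K - 1) K m
        rw [← hm, add_sub_cancel, h3, hb] at h5
        have h6 : (n : ℤ) * m = 0 := by linarith
        have h7 := (mul_eq_zero.1 h6).resolve_left (by exact_mod_cast NeZero.ne n)
        subst h7
        omega
      · omega
  have hi : ∀ s k, ψ.bead s k = φ.bead s k +
      if k = K ∧ (ℓ : ℤ) ∣ s - φ.firstRow i K then 1 else 0 := fun s k => by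
    rw [h, hK]
    split_ifs <;> ring
  have hlt : φ.firstRow i K < φ.firstRow (i - 1) K := by
    rw [lt_firstRow_iff, hK, h, hb, if_pos ⟨rfl, by simp⟩]
    omega
  rw [firstRow_of_move_right hlt hi]
  ring

theorem IsFirstMin.exists_f {ψ : DescAbacus n ℓ} {i : Fin n} {K : ℕ}
    (h1 : IsFirstMin (ψ.potential i) K) (h2 : ψ.firstRow i K < ψ.firstRow (i - 1) K) :
    ∃ φ, ψ.f i = some φ ∧ ∀ v k, φ.firstRow v k = ψ.firstRow v k + bump n i K v k := by
  obtain ⟨j, φ, hφ, hj, hb⟩ := ψ.exists_f_eq_some (ψ.isLeast_uncanceledOpen i h1 h2)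
  have h3 := ψ.firstRow_le_iff.1 (le_refl (ψ.firstRow i K))
  have h4 := ψ.lt_firstRow_iff.1 h2
  -- Both beads are at position `i` on the same row.
  obtain rfl : j = K := (ψ.bead_strictAnti (ψ.firstRow i K)).injective (by omega)
  exact ⟨φ, hφ, firstRow_of_move_right h2 hb⟩

theorem f_eq_some_iff {ψ φ : DescAbacus n ℓ} {i : Fin n} :
    ψ.f i = some φ ↔ ∃ K, IsFirstMin (ψ.potential i) K ∧
      ψ.firstRow i K < ψ.firstRow (i - 1) K ∧
      ∀ v k, φ.firstRow v k = ψ.firstRow v k + bump n i K v k := by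
  constructor
  · intro h
    obtain ⟨t, ht⟩ := exists_uncanceledOpen h
    obtain ⟨K, h1, h2⟩ := ψ.exists_isFirstMin_of_uncanceledOpen i ht
    obtain ⟨φ', h3, h4⟩ := h1.exists_f h2
    obtain rfl : φ = φ' := Option.some.inj (h.symm.trans h3)
    exact ⟨K, h1, h2, h4⟩
  · rintro ⟨K, h1, h2, h3⟩
    obtain ⟨φ', h4, h5⟩ := h1.exists_f h2
    rw [h4, Option.some_inj]
    exact ext_firstRow fun v k => by rw [h3, h5]

theorem IsLastMin.exists_e {ψ : DescAbacus n ℓ} {i : Fin n} {K : ℕ}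
    (h1 : IsLastMin (ψ.potential i) K) :
    ∃ φ, ψ.e i = some φ ∧ ∀ v k, φ.firstRow v k = ψ.firstRow v k - bump n i K v k := by
  obtain ⟨j, φ, hφ, hj, hb⟩ := ψ.exists_e_eq_some (ψ.isGreatest_uncanceledClose i h1)
  have h2 := h1.2 (K + 1) (by omega)
  have h3 := ψ.firstRow_anti (K + 1) (show (i : ℤ) - 1 ≤ i by omega)
  rw [potential_succ, gap, gap, sub_add_cancel] at h2
  have h4 := ψ.firstRow_le_iff.1
    (show ψ.firstRow (i + 1) K ≤ ψ.firstRow i K - 1 by omega)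
  have h5 := ψ.lt_firstRow_iff.1 (show ψ.firstRow i K - 1 < ψ.firstRow i K by omega)
  have h6 : ψ.bead (ψ.firstRow i K - 1) K = i + 1 := by omega
  obtain rfl : j = K := (ψ.bead_strictAnti (ψ.firstRow i K - 1)).injective (by omega)
  exact ⟨φ, hφ, firstRow_of_move_left h6 hb⟩

theorem e_eq_some_iff {ψ φ : DescAbacus n ℓ} {i : Fin n} :
    ψ.e i = some φ ↔ ∃ K, IsLastMin (ψ.potential i) K ∧
      ∀ v k, φ.firstRow v k = ψ.firstRow v k - bump n i K v k := by
  constructor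
  · intro h
    obtain ⟨t, ht⟩ := exists_uncanceledClose h
    obtain ⟨K, h1⟩ := ψ.exists_isLastMin_of_uncanceledClose i ht
    obtain ⟨φ', h3, h4⟩ := h1.exists_e
    obtain rfl : φ = φ' := Option.some.inj (h.symm.trans h3)
    exact ⟨K, h1, h4⟩
  · rintro ⟨K, h1, h3⟩
    obtain ⟨φ', h4, h5⟩ := h1.exists_e
    rw [h4, Option.some_inj]
    exact ext_firstRow fun v k => by rw [h3, h5]

end

/-! ### Commutation of the crystal operators with `T` and `Tstar` -/

section

variable {n ℓ : ℕ} [NeZero n]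

omit [NeZero n] in
-- As `n ≥ 2`, the values `i - 1` and `i + 1` are not congruent to `i`, so the only changes are that
-- `gap (i - 1) K` grows by 1 and, if `K > 0`, `gap i (K - 1)` shrinks by 1.
theorem potential_bump (hn : 2 ≤ n) {ψ φ : DescAbacus n ℓ} {i : ℤ} {K : ℕ}
    (h : ∀ v k, φ.firstRow v k = ψ.firstRow v k + bump n i K v k) (m : ℕ) :
    φ.potential i m = ψ.potential i m + (if K < m then 1 else 0) +
      (if K ≤ m ∧ 0 < K then 1 else 0) := by
  have hd : ¬ (n : ℤ) ∣ 1 := fun hd => by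
    have := Int.le_of_dvd one_pos hd
    omega
  induction m with
  | zero =>
    rw [if_neg (by omega), if_neg (by omega)]
    simp [potential]
  | succ m ih =>
    rw [potential_succ, potential_succ, ih]
    simp only [gap, sub_add_cancel, h, bump, sub_self, dvd_zero, add_sub_cancel_left, and_true,
      show i - 1 - i = -1 by ring, dvd_neg, hd, and_false, if_false]
    split_ifs <;> omega

/-- For `K > 0` the potential is raised by 0 before `K`, by 1 at `K` and by 2 after it; for `K = 0`,
by 0 at `K` and by 1 after it. Either way the first minimizer becomes the last one, and conversely.
-/
theorem e_eq_some_iff_f (hn : 2 ≤ n) {ψ φ : DescAbacus n ℓ} {i : Fin n} :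
    φ.e i = some ψ ↔ ψ.f i = some φ := by
  rw [f_eq_some_iff, e_eq_some_iff]
  refine exists_congr fun K => ?_
  have hb : bump n i K i K = 1 := if_pos ⟨rfl, by simp⟩
  have hb' : bump n i K (i - 1) K = 0 := if_neg fun hd => by
    have h1 := hd.2
    rw [show (i : ℤ) - 1 - i = -1 by ring, dvd_neg] at h1
    have := Int.le_of_dvd one_pos h1
    omega
  have hψ : (∀ v k, ψ.firstRow v k = φ.firstRow v k - bump n i K v k) ↔
      ∀ v k, φ.firstRow v k = ψ.firstRow v k + bump n i K v k :=
    forall₂_congr fun v k => by omega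
  rw [hψ]
  constructor
  · rintro ⟨h1, h2⟩
    have hp := potential_bump hn h2
    refine ⟨⟨fun m => ?_, fun m hm => ?_⟩, ?_, h2⟩
    · have h3 := hp m
      have h4 := hp K
      have h5 := h1.1 m
      have h6 := h1.2 m
      split_ifs at h3 h4 <;> omega
    · have h3 := hp m
      have h4 := hp K
      have h5 := h1.1 m
      split_ifs at h3 h4 <;> omega
    · have h3 := h2 i K
      have h4 := h2 (i - 1) K
      have h5 := φ.firstRow_anti K (show (i : ℤ) - 1 ≤ i by omega)
      omega
  · rintro ⟨h1, -, h2⟩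
    have hp := potential_bump hn h2
    refine ⟨⟨fun m => ?_, fun m hm => ?_⟩, h2⟩
    · have h3 := hp m
      have h4 := hp K
      have h5 := h1.1 m
      have h6 := h1.2 m
      split_ifs at h3 h4 <;> omega
    · have h3 := hp m
      have h4 := hp K
      have h5 := h1.1 m
      split_ifs at h3 h4 <;> omega

/-- Each `gap v j` changes by a constant independent of `v`, which cancels in the differences. -/
theorem potential_T {ψ χ : DescAbacus n ℓ} {k : ℕ} (h : ψ.T k = some χ) (i : ℤ) :
    χ.potential i = ψ.potential i := by
  rw [T_eq_some_iff] at h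
  funext m
  refine Finset.sum_congr rfl fun j _ => ?_
  simp only [gap, h]
  ring

theorem exists_f_of_T {ψ χ ω : DescAbacus n ℓ} {k : ℕ} {i : Fin n} (h : ψ.T k = some χ)
    (hf : χ.f i = some ω) : ∃ φ, ψ.f i = some φ ∧ φ.T k = some ω := by
  obtain ⟨K, h1, h2, h3⟩ := f_eq_some_iff.1 hf
  rw [potential_T h] at h1
  rw [T_eq_some_iff] at h
  obtain ⟨φ, h4, h5⟩ := h1.exists_f (by simpa [h] using h2)
  refine ⟨φ, h4, T_eq_some_iff.2 fun v j => ?_⟩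
  rw [h3, h5, h]
  ring

theorem exists_T_of_f {ψ χ φ : DescAbacus n ℓ} {k : ℕ} {i : Fin n} (h : ψ.T k = some χ)
    (hf : ψ.f i = some φ) : ∃ ω, χ.f i = some ω ∧ φ.T k = some ω := by
  obtain ⟨K, h1, h2, h3⟩ := f_eq_some_iff.1 hf
  rw [← potential_T h] at h1
  rw [T_eq_some_iff] at h
  obtain ⟨φ, h4, h5⟩ := h1.exists_f (by simpa [h] using h2)
  refine ⟨φ, h4, T_eq_some_iff.2 fun v j => ?_⟩
  rw [h3, h5, h]
  ring

theorem exists_e_of_T {ψ χ ω : DescAbacus n ℓ} {k : ℕ} {i : Fin n} (h : ψ.T k = some χ)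
    (he : χ.e i = some ω) : ∃ φ, ψ.e i = some φ ∧ φ.T k = some ω := by
  obtain ⟨K, h1, h3⟩ := e_eq_some_iff.1 he
  rw [potential_T h] at h1
  rw [T_eq_some_iff] at h
  obtain ⟨φ, h4, h5⟩ := h1.exists_e
  refine ⟨φ, h4, T_eq_some_iff.2 fun v j => ?_⟩
  rw [h3, h5, h]
  ring

theorem exists_T_of_e {ψ χ φ : DescAbacus n ℓ} {k : ℕ} {i : Fin n} (h : ψ.T k = some χ)
    (he : ψ.e i = some φ) : ∃ ω, χ.e i = some ω ∧ φ.T k = some ω := by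
  obtain ⟨K, h1, h3⟩ := e_eq_some_iff.1 he
  rw [← potential_T h] at h1
  rw [T_eq_some_iff] at h
  obtain ⟨φ, h4, h5⟩ := h1.exists_e
  refine ⟨φ, h4, T_eq_some_iff.2 fun v j => ?_⟩
  rw [h3, h5, h]
  ring

theorem T_bind_f (hn : 2 ≤ n) (i : Fin n) (k : ℕ) (ψ : DescAbacus n ℓ) :
    (ψ.T k).bind (f i) = (ψ.f i).bind (T k) := by
  ext ω
  simp only [Option.bind_eq_some_iff]
  constructor
  · rintro ⟨χ, h1, h2⟩
    exact exists_f_of_T h1 h2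
  · rintro ⟨φ, h1, h2⟩
    -- Here it is not yet known that `T k` applies to `ψ`. This follows by going back from `φ` to
    -- `ψ` with `e_i`, along which `T k` is transported.
    obtain ⟨χ, h3, h4⟩ := exists_T_of_e h2 ((e_eq_some_iff_f hn).2 h1)
    exact ⟨χ, h4, (e_eq_some_iff_f hn).1 h3⟩

theorem T_bind_e (hn : 2 ≤ n) (i : Fin n) (k : ℕ) (ψ : DescAbacus n ℓ) :
    (ψ.T k).bind (e i) = (ψ.e i).bind (T k) := by
  ext ω
  simp only [Option.bind_eq_some_iff]
  constructor
  · rintro ⟨χ, h1, h2⟩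
    exact exists_e_of_T h1 h2
  · rintro ⟨φ, h1, h2⟩
    obtain ⟨χ, h3, h4⟩ := exists_T_of_f h2 ((e_eq_some_iff_f hn).1 h1)
    exact ⟨χ, h4, (e_eq_some_iff_f hn).2 h3⟩

theorem Tstar_bind_f (hn : 2 ≤ n) (i : Fin n) (k : ℕ) (ψ : DescAbacus n ℓ) :
    (ψ.Tstar k).bind (f i) = (ψ.f i).bind (Tstar k) := by
  ext ω
  simp only [Option.bind_eq_some_iff, Tstar_eq_some_iff]
  constructor
  · rintro ⟨χ, h1, h2⟩
    exact exists_T_of_f h1 h2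
  · rintro ⟨φ, h1, h2⟩
    obtain ⟨χ, h3, h4⟩ := exists_e_of_T h2 ((e_eq_some_iff_f hn).2 h1)
    exact ⟨χ, h4, (e_eq_some_iff_f hn).1 h3⟩

theorem Tstar_bind_e (hn : 2 ≤ n) (i : Fin n) (k : ℕ) (ψ : DescAbacus n ℓ) :
    (ψ.Tstar k).bind (e i) = (ψ.e i).bind (Tstar k) := by
  ext ω
  simp only [Option.bind_eq_some_iff, Tstar_eq_some_iff]
  constructor
  · rintro ⟨χ, h1, h2⟩
    exact exists_T_of_e h1 h2
  · rintro ⟨φ, h1, h2⟩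
    obtain ⟨χ, h3, h4⟩ := exists_f_of_T h2 ((e_eq_some_iff_f hn).1 h1)
    exact ⟨χ, h4, (e_eq_some_iff_f hn).2 h3⟩

/-! ### Sources -/

theorem gap_periodic_mul (ψ : DescAbacus n ℓ) (v : ℤ) (k : ℕ) (m : ℤ) :
    ψ.gap (v + n * m) k = ψ.gap v k := by
  have h1 := ψ.firstRow_periodic_mul v (k + 1) m
  have h2 := ψ.firstRow_periodic_mul (v + 1) k m
  rw [gap, gap, h1, show v + (n : ℤ) * m + 1 = v + 1 + n * m by ring, h2]
  ring

/-- Minimality on the tail says that the sums of `gap v j` over `m ≤ j < N` are monotone in `v`.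
They are also periodic, hence constant, and consecutive `m` isolate a single gap. -/
theorem gap_eq_gap_of_e_eq_none (ψ : DescAbacus n ℓ) (h : ∀ i, ψ.e i = none) (k : ℕ) (v w : ℤ) :
    ψ.gap v k = ψ.gap w k := by
  obtain ⟨N, hN⟩ := ψ.potential_eventually
  have hmin : ∀ (i : Fin n) m, ψ.potential i N ≤ ψ.potential i m := fun i m => by
    by_contra! hc
    obtain ⟨K, hK⟩ := exists_isLastMin (hN i) hc
    obtain ⟨φ, hφ, -⟩ := hK.exists_e
    rw [h i] at hφ
    cases hφ
  have hpot : ∀ v q m, ψ.potential (v + n * q) m = ψ.potential v m := fun v q m => by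
    refine Finset.sum_congr rfl fun j _ => ?_
    rw [gap_periodic_mul, show v + (n : ℤ) * q - 1 = v - 1 + n * q by ring, gap_periodic_mul]
  have hmin' : ∀ (v : ℤ) m, ψ.potential v N ≤ ψ.potential v m := fun v m => by
    have hpos : (0 : ℤ) < n := by exact_mod_cast NeZero.pos n
    have h1 := Int.emod_nonneg v hpos.ne'
    have h2 := Int.emod_lt_of_pos v hpos
    have h3 := hmin ⟨(v % n).toNat, by omega⟩ m
    rw [Fin.val_mk, Int.toNat_of_nonneg h1, ← hpot _ (v / n) N, ← hpot _ (v / n) m,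
      Int.emod_add_mul_ediv] at h3
    exact h3
  have hS : ∀ v m, ψ.potential v m =
      ∑ j ∈ Finset.range m, ψ.gap (v - 1) j - ∑ j ∈ Finset.range m, ψ.gap v j := fun v m =>
    Finset.sum_sub_distrib _ _
  have hconst : ∀ m v w,
      ∑ j ∈ Finset.range N, ψ.gap v j - ∑ j ∈ Finset.range m, ψ.gap v j ≤
      ∑ j ∈ Finset.range N, ψ.gap w j - ∑ j ∈ Finset.range m, ψ.gap w j := fun m v w => by
    have hmono : Monotone fun v =>
        ∑ j ∈ Finset.range N, ψ.gap v j - ∑ j ∈ Finset.range m, ψ.gap v j := by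
      refine monotone_int_of_le_succ fun v => ?_
      have h1 := hmin' (v + 1) m
      rw [hS, hS, add_sub_cancel_right] at h1
      linarith
    -- Shifting `w` by a multiple of the period moves it past `v` without changing the sums.
    have h1 : v ≤ w + n * |v - w| := by
      have h2 := le_abs_self (v - w)
      have h3 := abs_nonneg (v - w)
      have h4 : (1 : ℤ) ≤ n := by exact_mod_cast NeZero.one_le
      nlinarith
    have h2 := hmono h1
    simpa only [gap_periodic_mul] using h2
  have h1 := hconst k v w
  have h2 := hconst (k + 1) v w
  have h3 := hconst k w v
  have h4 := hconst (k + 1) w v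
  simp only [Finset.sum_range_succ] at h2 h4
  linarith

theorem bead_succ_of_gap_eq_zero (ψ : DescAbacus n ℓ) {k : ℕ} (h : ∀ v, ψ.gap v k = 0) (t : ℤ) :
    ψ.bead t (k + 1) = ψ.bead t k - 1 := by
  refine eq_of_forall_ge_iff fun v => ?_
  rw [← firstRow_le_iff, ← sub_eq_zero.1 (h v), firstRow_le_iff]
  omega

omit [NeZero n] in
theorem bead_of_compact {ψ : DescAbacus n ℓ} (h : ψ.1.compactification = ψ.1) (t : ℤ) (k : ℕ) :
    ψ.bead t k = ψ.1.charge t - k :=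
  congrFun (congrFun (congrArg Abacus.bead h.symm) t) k

omit [NeZero n] in
theorem bead_succ_of_compact {ψ : DescAbacus n ℓ} (h : ψ.1.compactification = ψ.1) (t : ℤ)
    (k : ℕ) : ψ.bead t (k + 1) = ψ.bead t k - 1 := by
  rw [bead_of_compact h, bead_of_compact h]
  push_cast
  ring

omit [NeZero n] in
theorem compact_of_bead_succ {ψ : DescAbacus n ℓ} (h : ∀ t k, ψ.bead t (k + 1) = ψ.bead t k - 1) :
    ψ.1.compactification = ψ.1 := by
  have hb : ∀ t k, ψ.bead t k = ψ.bead t 0 - k := fun t k => by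
    induction k with
    | zero => simp
    | succ k ih =>
      rw [h, ih]
      push_cast
      ring
  have hc : ∀ t, ψ.1.charge t = ψ.bead t 0 := fun t =>
    ψ.charge_eq (Eventually.of_forall (hb t))
  refine Abacus.ext (funext fun t => funext fun k => ?_)
  show ψ.1.charge t - k = ψ.bead t k
  rw [hc, hb t k]

theorem T_of_compact {ψ : DescAbacus n ℓ} (h : ψ.1.compactification = ψ.1) (k : ℕ) :
    ψ.T k = none :=
  T_eq_none_iff.2 ⟨0, ψ.gap_eq_zero_of_bead_succ (fun t => bead_succ_of_compact h t k) 0⟩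

theorem e_of_compact {ψ : DescAbacus n ℓ} (h : ψ.1.compactification = ψ.1) (i : Fin n) :
    ψ.e i = none := by
  refine Option.eq_none_iff_forall_ne_some.2 fun φ hφ => ?_
  obtain ⟨K, hK, -⟩ := e_eq_some_iff.1 hφ
  have h1 := hK.2 (K + 1) (by omega)
  have hg := ψ.gap_eq_zero_of_bead_succ fun t => bead_succ_of_compact h t K
  rw [potential_succ, hg, hg] at h1
  omega

/-- A configuration to which no `e_i` and no `T_k` applies is compact. -/
theorem compact_of_eq_none {ψ : DescAbacus n ℓ} (he : ∀ i, ψ.e i = none) (hT : ∀ k, ψ.T k = none) :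
    ψ.1.compactification = ψ.1 := by
  refine compact_of_bead_succ fun t k => ψ.bead_succ_of_gap_eq_zero (fun v => ?_) t
  obtain ⟨w, hw⟩ := T_eq_none_iff.1 (hT k)
  rw [ψ.gap_eq_gap_of_e_eq_none he k v w, hw]

/-! ### Tight configurations -/

/-- The rows of the extended abacus with bead `k` exactly at `v` form an interval, and reduction
modulo `ℓ` maps it bijectively to the physical rows with that residue. -/
theorem count_residues (ψ : DescAbacus n ℓ) (k : ℕ) (v : ℤ) :
    ((ψ.residues k).count (v : ZMod n) : ℤ) = ψ.firstRow (v - 1) k - ψ.firstRow v k := by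
  classical
  have hℓ : (0 : ℤ) < ℓ := by
    by_contra! h0
    have h1 := ψ.firstRow_periodic_mul 0 0 1
    have h2 := ψ.bead_periodic_mul 0 0 1
    have h3 := NeZero.ne n
    obtain rfl : ℓ = 0 := by omega
    simp at h2
    omega
  have hn : (n : ℤ) ≠ 0 := by exact_mod_cast NeZero.ne n
  have hmod : ∀ r : ℤ, (v : ZMod n) = (ψ.bead r k : ZMod n) ↔ (n : ℤ) ∣ ψ.bead r k - v := fun r =>
    ZMod.intCast_eq_intCast_iff_dvd_sub _ _ _
  have hv : ∀ t, ψ.firstRow v k ≤ t ∧ t < ψ.firstRow (v - 1) k ↔ ψ.bead t k = v := fun t => by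
    rw [firstRow_le_iff, lt_firstRow_iff]
    omega
  have hle := ψ.firstRow_anti k (show v - 1 ≤ v by omega)
  have hcard : (Finset.Ico (ψ.firstRow v k) (ψ.firstRow (v - 1) k)).card =
      ((Finset.range ℓ).filter fun r : ℕ => (v : ZMod n) = (ψ.bead r k : ZMod n)).card := by
    refine Finset.card_bij (fun t _ => (t % ℓ).toNat) ?_ ?_ ?_
    · intro t ht
      rw [Finset.mem_Ico, hv] at ht
      have h1 := Int.emod_nonneg t hℓ.ne'
      have h2 := Int.emod_lt_of_pos t hℓ
      have h3 := ψ.bead_periodic_mul (t % ℓ) k (t / ℓ)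
      rw [Int.emod_add_mul_ediv, ht] at h3
      rw [Finset.mem_filter, Finset.mem_range, hmod, Int.toNat_of_nonneg h1]
      exact ⟨by omega, t / ℓ, by linarith⟩
    · intro t ht s hs hts
      rw [Finset.mem_Ico, hv] at ht hs
      have h1 := Int.emod_nonneg t hℓ.ne'
      have h2 := Int.emod_nonneg s hℓ.ne'
      have h3 : t % ℓ = s % ℓ := by omega
      have h4 := ψ.bead_periodic_mul (t % ℓ) k (t / ℓ)
      have h5 := ψ.bead_periodic_mul (s % ℓ) k (s / ℓ)
      rw [Int.emod_add_mul_ediv, ht] at h4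
      rw [Int.emod_add_mul_ediv, hs, ← h3] at h5
      have h6 : t / ℓ = s / ℓ := mul_left_cancel₀ hn (by linarith)
      rw [← Int.emod_add_mul_ediv t ℓ, ← Int.emod_add_mul_ediv s ℓ, h3, h6]
    · intro r hr
      rw [Finset.mem_filter, Finset.mem_range, hmod] at hr
      obtain ⟨hr, q, hq⟩ := hr
      refine ⟨r + ℓ * q, ?_, ?_⟩
      · rw [Finset.mem_Ico, hv, bead_periodic_mul]
        linarith
      · rw [Int.add_mul_emod_self_left, Int.emod_eq_of_lt (by omega) (by omega)]
        simp
  have hres : ψ.residues k = (Finset.range ℓ).val.map fun r : ℕ => (ψ.bead r k : ZMod n) := by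
    simp [residues, Multiset.bind_def, Multiset.pure_def, Multiset.bind_singleton]
  rw [hres, Multiset.count_map]
  rw [Int.card_Ico] at hcard
  change (((Finset.range ℓ).filter fun r : ℕ =>
    (v : ZMod n) = (ψ.bead r k : ZMod n)).card : ℤ) = _
  omega

/-- The residue counts are the successive differences of `firstRow · k`, so they determine it up to
an additive constant. Thus the competitors in `IsTight` form a one-parameter family of row shifts.
-/
theorem residues_eq_iff {ψ φ : DescAbacus n ℓ} {k : ℕ} :
    φ.residues k = ψ.residues k ↔ ∃ s, ∀ v, φ.firstRow v k = ψ.firstRow v k + s := by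
  constructor
  · intro h
    have h1 : ∀ v, φ.firstRow (v - 1) k - φ.firstRow v k =
        ψ.firstRow (v - 1) k - ψ.firstRow v k := fun v => by
      rw [← count_residues, ← count_residues, h]
    refine ⟨φ.firstRow 0 k - ψ.firstRow 0 k, fun v => ?_⟩
    induction v using Int.induction_on with
    | zero => ring
    | succ v ih =>
      have := h1 (v + 1)
      rw [add_sub_cancel_right] at this
      linarith
    | pred v ih =>
      have := h1 (-v)
      linarith
  · rintro ⟨s, hs⟩
    refine Multiset.ext.2 fun a => ?_
    obtain ⟨v, rfl⟩ := ZMod.intCast_surjective a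
    zify
    rw [count_residues, count_residues, hs, hs]
    ring

theorem bead_eq_of_firstRow_eq {ψ φ : DescAbacus n ℓ} {k : ℕ}
    (h : ∀ v, φ.firstRow v k = ψ.firstRow v k) (t : ℤ) : φ.bead t k = ψ.bead t k :=
  eq_of_forall_ge_iff fun v => by rw [← firstRow_le_iff, ← firstRow_le_iff, h]

theorem firstRow_eq_of_bead_eq {ψ φ : DescAbacus n ℓ} {k : ℕ}
    (h : ∀ t, φ.bead t k = ψ.bead t k) (v : ℤ) : φ.firstRow v k = ψ.firstRow v k :=
  eq_of_forall_ge_iff fun t => by rw [firstRow_le_iff, firstRow_le_iff, h]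

theorem bead_le_of_firstRow_le {ψ φ : DescAbacus n ℓ} {k : ℕ}
    (h : ∀ v, φ.firstRow v k ≤ ψ.firstRow v k) (t : ℤ) : φ.bead t k ≤ ψ.bead t k :=
  φ.firstRow_le_iff.1 ((h _).trans (ψ.firstRow_le_iff.2 le_rfl))

theorem isTight_iff {ψ : DescAbacus n ℓ} : ψ.IsTight ↔ ∀ k, ψ.T k = none := by
  constructor
  · intro h k
    refine Option.eq_none_iff_forall_ne_some.2 fun φ hφ => ?_
    have h1 := T_eq_some_iff.1 hφ
    have h2 : ∀ v, φ.firstRow v k = ψ.firstRow v k + -1 := fun v => by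
      rw [h1, if_pos rfl]
      ring
    have h3 := h k φ
      (fun t j hj => bead_eq_of_firstRow_eq (fun v => by rw [h1, if_neg hj, sub_zero]) t)
      (residues_eq_iff.2 ⟨-1, h2⟩)
    have h4 := ψ.firstRow_le_iff.2 ((h3 _).trans (φ.firstRow_le_iff.1 (le_refl (φ.firstRow 0 k))))
    have h5 := h2 0
    omega
  · intro h k φ hφ hres
    obtain ⟨s, hs⟩ := residues_eq_iff.1 hres
    obtain ⟨v, hv⟩ := T_eq_none_iff.1 (h k)
    have h1 := φ.gap_nonneg v k
    have h2 := firstRow_eq_of_bead_eq (fun t => hφ t (k + 1) (by omega)) v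
    rw [gap] at h1 hv
    -- At a vanishing gap of `ψ`, the gap of the competitor equals the shift `s`, so `s ≥ 0`.
    rw [h2, hs] at h1
    refine bead_le_of_firstRow_le fun w => ?_
    rw [hs]
    omega

end

/-! ### Reduction to the compactification and the structure of the graph -/

section

variable {n ℓ : ℕ}

/-- The number of steps to the left which the beads of the rows `0, …, ℓ - 1` can make. -/
noncomputable def weight (ψ : DescAbacus n ℓ) : ℕ :=
  ∑ᶠ k : ℕ, ∑ r ∈ Finset.range ℓ, (ψ.bead r k - (ψ.1.charge r - k)).toNat

theorem weight_eq_sum {ψ : DescAbacus n ℓ} {N : ℕ}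
    (h : ∀ t j, N ≤ j → ψ.bead t j = ψ.1.charge t - j) :
    ψ.weight =
      ∑ k ∈ Finset.range N, ∑ r ∈ Finset.range ℓ, (ψ.bead r k - (ψ.1.charge r - k)).toNat := by
  refine finsum_eq_sum_of_support_subset _ fun k hk => ?_
  by_contra hN
  refine hk (Finset.sum_eq_zero fun r _ => ?_)
  rw [h r k (by simpa using hN)]
  simp

/-- Hence `toNat` in `weight` never truncates. -/
theorem charge_sub_le_bead (ψ : DescAbacus n ℓ) (t : ℤ) (k : ℕ) :
    ψ.1.charge t - k ≤ ψ.bead t k := by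
  obtain ⟨j, hj, hkj⟩ := ((ψ.1.charge_spec t).and (eventually_ge_atTop k)).exists
  have h : ∀ m, k ≤ m → ψ.bead t m + m ≤ ψ.bead t k + k := fun m hm => by
    induction m, hm using Nat.le_induction with
    | base => rfl
    | succ m hm ih =>
      have := ψ.bead_strictAnti t (Nat.lt_succ_self m)
      simp only [Nat.succ_eq_add_one] at this
      push_cast
      omega
  have := h j hkj
  unfold bead at *
  omega

variable [NeZero n]

theorem weight_lt_weight {ψ φ : DescAbacus n ℓ} (hc : φ.1.charge = ψ.1.charge)
    (hle : ∀ t k, φ.bead t k ≤ ψ.bead t k) (hne : φ ≠ ψ) : φ.weight < ψ.weight := by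
  obtain ⟨N₁, h₁⟩ := ψ.exists_packed
  obtain ⟨N₂, h₂⟩ := φ.exists_packed
  have hlt : ∃ t k, φ.bead t k < ψ.bead t k := by
    by_contra! hge
    exact hne (ext_bead fun t k => (hle t k).antisymm (hge t k))
  obtain ⟨t, k, htk⟩ := hlt
  have hℓ : (0 : ℤ) < ℓ := by
    by_contra! h0
    have h1 := ψ.bead_periodic_mul 0 0 1
    have h2 := NeZero.ne n
    obtain rfl : ℓ = 0 := by omega
    simp at h1
    omega
  have hr1 := Int.emod_nonneg t hℓ.ne'
  have hr2 := Int.emod_lt_of_pos t hℓ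
  have hr3 := ψ.bead_periodic_mul (t % ℓ) k (t / ℓ)
  have hr4 := φ.bead_periodic_mul (t % ℓ) k (t / ℓ)
  rw [Int.emod_add_mul_ediv] at hr3 hr4
  have hk : k < N₁ + N₂ := by
    by_contra! hk
    rw [h₁ t k (by omega), h₂ t k (by omega), hc] at htk
    omega
  rw [weight_eq_sum (N := N₁ + N₂) fun t j hj => h₁ t j (by omega),
    weight_eq_sum (N := N₁ + N₂) fun t j hj => h₂ t j (by omega), hc]
  have hterm : ∀ r j, (φ.bead r j - (ψ.1.charge r - j)).toNat ≤
      (ψ.bead r j - (ψ.1.charge r - j)).toNat := fun r j => by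
    have := hle r j
    omega
  refine Finset.sum_lt_sum (fun j _ => Finset.sum_le_sum fun r _ => hterm r j)
    ⟨k, by simpa using hk, Finset.sum_lt_sum (fun r _ => hterm r k)
      ⟨(t % ℓ).toNat, by simp; omega, ?_⟩⟩
  rw [Int.toNat_of_nonneg hr1]
  have := φ.charge_sub_le_bead (t % ℓ) k
  rw [hc] at this
  omega

omit [NeZero n] in
theorem compactification_eq {ψ φ : DescAbacus n ℓ} (h : φ.1.charge = ψ.1.charge) :
    φ.1.compactification = ψ.1.compactification := by
  refine Abacus.ext (funext fun t => funext fun k => ?_)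
  show φ.1.charge t - (k : ℤ) = ψ.1.charge t - k
  rw [h]

theorem charge_eq_charge {ψ φ : DescAbacus n ℓ} {K : ℕ}
    (h : ∀ v j, j ≠ K → φ.firstRow v j = ψ.firstRow v j) : φ.1.charge = ψ.1.charge := by
  funext t
  refine φ.charge_eq ?_
  filter_upwards [ψ.1.charge_spec t, eventually_gt_atTop K] with j hj hK
  rw [bead_eq_of_firstRow_eq fun v => h v j hK.ne']
  exact hj

theorem charge_of_e {ψ φ : DescAbacus n ℓ} {i : Fin n} (h : ψ.e i = some φ) :
    φ.1.charge = ψ.1.charge := by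
  obtain ⟨K, -, h⟩ := e_eq_some_iff.1 h
  exact charge_eq_charge (K := K) fun v j hj => by simp [h, bump, hj]

theorem charge_of_T {ψ φ : DescAbacus n ℓ} {k : ℕ} (h : ψ.T k = some φ) :
    φ.1.charge = ψ.1.charge :=
  charge_eq_charge (K := k) fun v j hj => by simp [T_eq_some_iff.1 h, hj]

theorem weight_of_e {ψ φ : DescAbacus n ℓ} {i : Fin n} (h : ψ.e i = some φ) :
    φ.weight < ψ.weight := by
  have hc := charge_of_e h
  obtain ⟨K, -, h⟩ := e_eq_some_iff.1 h
  refine weight_lt_weight hc (fun t k => bead_le_of_firstRow_le (fun v => ?_) t) ?_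
  · rw [h, bump]
    split_ifs <;> omega
  · rintro rfl
    have := h i K
    simp [bump] at this
    omega

theorem weight_of_T {ψ φ : DescAbacus n ℓ} {k : ℕ} (h : ψ.T k = some φ) :
    φ.weight < ψ.weight := by
  have hc := charge_of_T h
  rw [T_eq_some_iff] at h
  refine weight_lt_weight hc (fun t j => bead_le_of_firstRow_le (fun v => ?_) t) ?_
  · rw [h]
    split_ifs <;> omega
  · rintro rfl
    have := h 0 k
    simp at this
    omega

theorem isSource_iff (hn : 2 ≤ n) {ψ₀ : DescAbacus n ℓ} {φ : Vertex ψ₀} :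
    IsSource φ ↔ ∀ i, φ.1.e i = none := by
  constructor
  · intro h i
    refine Option.eq_none_iff_forall_ne_some.2 fun χ hχ => ?_
    exact h i ⟨χ, (compactification_eq (charge_of_e hχ)).trans φ.2⟩ ((e_eq_some_iff_f hn).1 hχ)
  · intro h i ψ hψ
    have := (e_eq_some_iff_f hn).2 hψ
    rw [h i] at this
    cases this

/-- Every configuration can be brought to its compactification by the operators `e_i` and
`T_k`. -/
theorem induction_of_compactification {ψ₀ : DescAbacus n ℓ} {p : DescAbacus n ℓ → Prop}
    (h₀ : p ψ₀)
    (he : ∀ ψ φ i, φ.1.compactification = ψ₀.1 → ψ.e i = some φ → p φ → p ψ)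
    (hT : ∀ ψ φ k, φ.1.compactification = ψ₀.1 → ψ.T k = some φ → p φ → p ψ)
    (ψ : DescAbacus n ℓ) (hψ : ψ.1.compactification = ψ₀.1) : p ψ := by
  induction hw : ψ.weight using Nat.strong_induction_on generalizing ψ with
  | _ w ih =>
    by_cases h1 : ∃ i φ, ψ.e i = some φ
    · obtain ⟨i, φ, h⟩ := h1
      have hφ := (compactification_eq (charge_of_e h)).trans hψ
      exact he ψ φ i hφ h (ih _ (hw ▸ weight_of_e h) φ hφ rfl)
    by_cases h2 : ∃ k φ, ψ.T k = some φ
    · obtain ⟨k, φ, h⟩ := h2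
      have hφ := (compactification_eq (charge_of_T h)).trans hψ
      exact hT ψ φ k hφ h (ih _ (hw ▸ weight_of_T h) φ hφ rfl)
    push Not at h1 h2
    have hc := compact_of_eq_none (fun i => Option.eq_none_iff_forall_ne_some.2 (h1 i))
      fun k => Option.eq_none_iff_forall_ne_some.2 (h2 k)
    obtain rfl : ψ = ψ₀ := Subtype.ext (hc.symm.trans hψ)
    exact h₀

theorem sources (hn : 2 ≤ n) {ψ₀ : DescAbacus n ℓ} (h₀ : ψ₀.1.compactification = ψ₀.1)
    (ψ : DescAbacus n ℓ) :
    (∃ hψ : ψ.1.compactification = ψ₀.1, IsSource (⟨ψ, hψ⟩ : Vertex ψ₀)) ↔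
      Relation.ReflTransGen (fun α β : DescAbacus n ℓ => ∃ k, α.Tstar k = some β) ψ₀ ψ := by
  refine (exists_congr fun _ => isSource_iff hn).trans ?_
  constructor
  · rintro ⟨hψ, h⟩
    refine induction_of_compactification
      (p := fun ψ => (∀ i, ψ.e i = none) → Relation.ReflTransGen _ ψ₀ ψ)
      (fun _ => .refl) ?_ ?_ ψ hψ h
    · intro ψ φ i _ h1 _ h2
      rw [h2 i] at h1
      cases h1
    · intro ψ φ k _ h1 ih h2
      refine (ih fun i => ?_).tail ⟨k, Tstar_eq_some_iff.2 h1⟩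
      -- Commutation passes the vanishing of all `e_i` on to `φ`, so the reduction of a source uses
      -- only `T k`; read backwards, it is a chain of `Tstar` moves.
      have := T_bind_e hn i k ψ
      rwa [h1, h2 i] at this
  · intro h
    induction h with
    | refl => exact ⟨h₀, e_of_compact h₀⟩
    | @tail α β _ hαβ ih =>
      obtain ⟨k, hk⟩ := hαβ
      obtain ⟨h1, h2⟩ := ih
      refine ⟨(compactification_eq (charge_of_T (Tstar_eq_some_iff.1 hk)).symm).trans h1,
        fun i => ?_⟩
      have h3 := Tstar_bind_e hn i k α
      have h4 : α.e i = none := h2 i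
      rwa [hk, h4] at h3

omit [NeZero n] in
theorem reachable_graph {ψ₀ : DescAbacus n ℓ} {i : Fin n} {ψ φ : Vertex ψ₀}
    (h : ψ.1.f i = some φ.1) : (graph ψ₀).Reachable ψ φ := by
  by_cases hne : ψ = φ
  · rw [hne]
  · exact SimpleGraph.Adj.reachable ((SimpleGraph.fromRel_adj _ _ _).2 ⟨hne, Or.inl ⟨i, h⟩⟩)

omit [NeZero n] in
theorem reachable_graphWithT {ψ₀ : DescAbacus n ℓ} {ψ φ : Vertex ψ₀}
    (h : (∃ i, Edge ψ₀ i ψ φ) ∨ ∃ k, ψ.1.T k = some φ.1) : (graphWithT ψ₀).Reachable ψ φ := by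
  by_cases hne : ψ = φ
  · rw [hne]
  · exact SimpleGraph.Adj.reachable ((SimpleGraph.fromRel_adj _ _ _).2 ⟨hne, Or.inl h⟩)

theorem isTight_iff_of_f (hn : 2 ≤ n) {ψ φ : DescAbacus n ℓ} {i : Fin n} (h : ψ.f i = some φ) :
    ψ.IsTight ↔ φ.IsTight := by
  rw [isTight_iff, isTight_iff]
  refine forall_congr' fun k => ?_
  have h1 := T_bind_f hn i k ψ
  have h2 := T_bind_e hn i k φ
  rw [h] at h1
  rw [(e_eq_some_iff_f hn).2 h] at h2
  constructor
  · intro h3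
    rw [h3] at h1
    exact h1.symm
  · intro h3
    rw [h3] at h2
    exact h2.symm

theorem exists_component_eq_tight (hn : 2 ≤ n) {ψ₀ : DescAbacus n ℓ}
    (h₀ : ψ₀.1.compactification = ψ₀.1) :
    ∃ C : (graph ψ₀).ConnectedComponent, C.supp = {ψ | ψ.1.IsTight} := by
  refine ⟨(graph ψ₀).connectedComponentMk ⟨ψ₀, h₀⟩, Set.ext fun ψ => ?_⟩
  refine SimpleGraph.ConnectedComponent.eq.trans ?_
  change _ ↔ ψ.1.IsTight
  constructor
  · intro h
    have h1 := (SimpleGraph.reachable_iff_reflTransGen _ _).1 h.symm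
    induction h1 with
    | refl => exact isTight_iff.2 (T_of_compact h₀)
    | @tail α β hα hαβ ih =>
      have h2 := ih ((SimpleGraph.reachable_iff_reflTransGen _ _).2 hα).symm
      obtain ⟨-, ⟨i, h3⟩ | ⟨i, h3⟩⟩ := (SimpleGraph.fromRel_adj _ _ _).1 hαβ
      · exact (isTight_iff_of_f hn h3).1 h2
      · exact (isTight_iff_of_f hn h3).2 h2
  · intro h
    refine induction_of_compactification (ψ₀ := ψ₀) (p := fun ψ => ψ.IsTight →
      ∀ hψ : ψ.1.compactification = ψ₀.1, (graph ψ₀).Reachable ⟨ψ, hψ⟩ ⟨ψ₀, h₀⟩)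
      (fun _ _ => .rfl) ?_ ?_ ψ.1 ψ.2 h ψ.2
    · intro ψ φ i hφ h1 ih h2 hψ
      have h3 := (e_eq_some_iff_f hn).1 h1
      exact (reachable_graph (φ := ⟨ψ, hψ⟩) h3).symm.trans
        (ih ((isTight_iff_of_f hn h3).2 h2) hφ)
    · intro ψ φ k _ h1 _ h2
      -- A tight configuration admits no `T k`, so its reduction stays within the edges of the
      -- graph.
      rw [isTight_iff.1 h2 k] at h1
      cases h1

theorem graphWithT_connected (hn : 2 ≤ n) {ψ₀ : DescAbacus n ℓ}
    (h₀ : ψ₀.1.compactification = ψ₀.1) : (graphWithT ψ₀).Connected := by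
  refine (SimpleGraph.connected_iff_exists_forall_reachable _).2 ⟨⟨ψ₀, h₀⟩, fun ψ => ?_⟩
  refine induction_of_compactification (ψ₀ := ψ₀) (p := fun ψ =>
    ∀ hψ : ψ.1.compactification = ψ₀.1, (graphWithT ψ₀).Reachable ⟨ψ₀, h₀⟩ ⟨ψ, hψ⟩)
    (fun _ => .rfl) ?_ ?_ ψ.1 ψ.2 ψ.2
  · intro ψ φ i hφ h1 ih hψ
    exact (ih hφ).trans
      (reachable_graphWithT (φ := ⟨ψ, hψ⟩) (Or.inl ⟨i, (e_eq_some_iff_f hn).1 h1⟩))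
  · intro ψ φ k hφ h1 ih hψ
    exact (ih hφ).trans (reachable_graphWithT (ψ := ⟨ψ, hψ⟩) (Or.inr ⟨k, h1⟩)).symm

end

end DescAbacus

theorem mainTheorem7 (n ℓ : ℕ) (hn : 2 ≤ n) (hℓ : 1 ≤ ℓ) :
    (∀ (i : Fin n) (k : ℕ) (ψ : DescAbacus n ℓ),
      (ψ.T k).bind (DescAbacus.e i) = (ψ.e i).bind (DescAbacus.T k) ∧
      (ψ.T k).bind (DescAbacus.f i) = (ψ.f i).bind (DescAbacus.T k) ∧
      (ψ.Tstar k).bind (DescAbacus.e i) = (ψ.e i).bind (DescAbacus.Tstar k) ∧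
      (ψ.Tstar k).bind (DescAbacus.f i) = (ψ.f i).bind (DescAbacus.Tstar k)) ∧
    ∀ ψ₀ : DescAbacus n ℓ, ψ₀.1.compactification = ψ₀.1 →
      (∀ ψ : DescAbacus n ℓ,
        (∃ hψ : ψ.1.compactification = ψ₀.1,
          DescAbacus.IsSource (⟨ψ, hψ⟩ : DescAbacus.Vertex ψ₀)) ↔
        Relation.ReflTransGen (fun α β : DescAbacus n ℓ => ∃ k, α.Tstar k = some β) ψ₀ ψ) ∧
      (∃ C : (DescAbacus.graph ψ₀).ConnectedComponent, C.supp = {ψ | ψ.1.IsTight}) ∧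
      (DescAbacus.graphWithT ψ₀).Connected := by
  have : NeZero n := ⟨by omega⟩
  exact ⟨fun i k ψ => ⟨DescAbacus.T_bind_e hn i k ψ, DescAbacus.T_bind_f hn i k ψ,
      DescAbacus.Tstar_bind_e hn i k ψ, DescAbacus.Tstar_bind_f hn i k ψ⟩,
    fun ψ₀ h₀ => ⟨DescAbacus.sources hn h₀, DescAbacus.exists_component_eq_tight hn h₀,
      DescAbacus.graphWithT_connected hn h₀⟩⟩
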